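/- Let $M\ge 2$ and $n\ge 1$ be integers, $\tau>0$, $R>0$, $\sigma\in\mathbb R$ and $\lambda^*\in\mathbb R^M$; write $\|\lambda\|_1=\sum_{j=1}^M|\lambda_j|$. Let $(X_1,Y_1),\dots,(X_n,Y_n)$ be i.i.d. random elements of $\mathbb R^M\times\mathbb R$ following the linear model $$Y_i=X_i^\top\lambda^*+\xi_i,\qquad i=1,\dots,n .$$ Assume that the support of the distribution of $X_1$ is included in $[-1,1]^M$ and that, for every $t\in\mathbb R$, $e^{t\xi_1}$ is integrable and $\mathbf E[e^{t\xi_1}\mid X_1]\le e^{\sigma^2t^2/2}$ almost surely. Let $\pi$ be the sparsity prior, i.e. the probability measure on $\mathbb R^M$ given by $$\pi(d\lambda)=\frac1{C_{\tau,R}}\Big\{\prod_{j=1}^M(\tau^2+\lambda_j^2)^{-2}\Big\}\mathbf 1(\|\lambda\|_1\le R)\,d\lambda ,$$ where $C_{\tau,R}$ is the normalizing constant. For $\beta>0$ and $m=0,1,\dots,n$ put $$\hat\theta_{m,\lambda}=\frac{\exp\{-\beta^{-1}\sum_{i=1}^m(Y_i-X_i^\top\lambda)^2\}}{\int_{\mathbb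 R^M}\exp\{-\beta^{-1}\sum_{i=1}^m(Y_i-X_i^\top w)^2\}\,\pi(dw)}$$ (so that $\hat\theta_{0,\lambda}=1$), and let $$\hat\lambda_n=\frac1{n+1}\sum_{m=0}^n\int_{\mathbb R^M}\lambda\,\hat\theta_{m,\lambda}\,\pi(d\lambda)$$ be the mirror averaging (MA) estimate. Set $\Sigma_X=\mathbf E[X_1X_1^\top]$, and let $\Sigma_X^{1/2}$ be its positive semidefinite square root and $\|\cdot\|_2$ the Euclidean norm. If $\beta\ge 2\sigma^2+2(R+\|\lambda^*\|_1)^2$ and $\|\lambda^*\|_1\le R-2M\tau$, then $\|\Sigma_X^{1/2}(\hat\lambda_n-\lambda^*)\|_2^2$ is integrable and $$\mathbf E\big[\|\Sigma_X^{1/2}(\hat\lambda_n-\lambda^*)\|_2^2\big]\le\frac{\beta}{n+1}\Big(1+4\sum_{j=1}^M\log\big(1+\tau^{-1}|\lambda^*_j|\big)\Big)+4\tau^2\operatorname{tr}(\Sigma_X).$$ -/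

import Mathlib

open MeasureTheory ProbabilityTheory
open scoped ENNReal Matrix MatrixOrder Matrix.Norms.L2Operator

noncomputable section

/-- The `ℓ₁`-norm of a vector of `ℝ^M`. -/
def l1norm {M : ℕ} (lam : Fin M → ℝ) : ℝ := ∑ j, |lam j|

/-- The unnormalized Lebesgue density of the sparsity prior,
`∏ⱼ (τ² + λⱼ²)⁻² · 1(‖λ‖₁ ≤ R)`. -/
def sparsityWeight {M : ℕ} (τ R : ℝ) (lam : Fin M → ℝ) : ℝ≥0∞ :=
  Set.indicator {v : Fin M → ℝ | l1norm v ≤ R}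
    (fun v => ENNReal.ofReal (∏ j, ((τ ^ 2 + v j ^ 2) ^ 2)⁻¹)) lam

/-- The sparsity prior on `ℝ^M`: the probability measure whose Lebesgue density is proportional
to `sparsityWeight τ R`. -/
def sparsityPrior (M : ℕ) (τ R : ℝ) : Measure (Fin M → ℝ) :=
  (∫⁻ v : Fin M → ℝ, sparsityWeight τ R v)⁻¹ • volume.withDensity (sparsityWeight τ R)

/-- The unnormalized posterior weight `exp (-β⁻¹ ∑_{i ≤ m} (Yᵢ - Xᵢᵀ λ)²)` of the parameter `lam`
computed from the first `m` observations. -/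
def expWeight {M n : ℕ} (β : ℝ) (x : Fin n → Fin M → ℝ) (y : Fin n → ℝ) (m : ℕ)
    (lam : Fin M → ℝ) : ℝ :=
  Real.exp (-(1 / β) *
    ∑ i ∈ Finset.univ.filter (fun i : Fin n => (i : ℕ) < m), (y i - x i ⬝ᵥ lam) ^ 2)

/-- The posterior density `θ̂_{m,λ}` with respect to the sparsity prior, computed from the first
`m` observations. For `m = 0` it is identically `1`. -/
def posteriorDensity {M n : ℕ} (τ R β : ℝ) (x : Fin n → Fin M → ℝ) (y : Fin n → ℝ) (m : ℕ)
    (lam : Fin M → ℝ) : ℝ :=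
  expWeight β x y m lam / ∫ w, expWeight β x y m w ∂(sparsityPrior M τ R)

/-- The mirror averaging estimate
`λ̂ₙ = (n + 1)⁻¹ ∑_{m=0}^n ∫ λ θ̂_{m,λ} π(dλ)`, coordinate by coordinate. -/
def mirrorAveraging {M n : ℕ} (τ R β : ℝ) (x : Fin n → Fin M → ℝ) (y : Fin n → ℝ) :
    Fin M → ℝ :=
  fun j => 1 / ((n : ℝ) + 1) * ∑ m ∈ Finset.range (n + 1),
    ∫ lam, lam j * posteriorDensity τ R β x y m lam ∂(sparsityPrior M τ R)

/-- The second moment matrix `Σ_X = E[X Xᵀ]` of a random vector `X`. -/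
def secondMoment {Ω : Type*} [MeasurableSpace Ω] {M : ℕ} (μ : Measure Ω) (X : Ω → Fin M → ℝ) :
    Matrix (Fin M) (Fin M) ℝ :=
  Matrix.of fun j k => ∫ ω, X ω j * X ω k ∂μ

/-- `‖A^{1/2} v‖₂²`, where `A^{1/2}` is the positive semidefinite square root of `A` and `‖·‖₂` is
the Euclidean norm. -/
def sqrtNormSq {M : ℕ} (A : Matrix (Fin M) (Fin M) ℝ) (v : Fin M → ℝ) : ℝ :=
  ‖WithLp.toLp 2 (CFC.sqrt A *ᵥ v)‖ ^ 2

end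

/-! ### The sparsity prior -/

/-! The argument bounds a telescoping log-evidence from both sides. Let `Z_m` be the evidence of `m`
observations, that is the prior integral of `exp(-β⁻¹ · sum of squared residuals)`.

One-step inequality (`IsSubGaussianModel.predRisk_mean_le`): if `P` lives on the `ℓ₁`-ball of radius
`R`, the expected squared residual of its mean is at most `-β E log ∫ exp(-resid²/β) dP`.
Integrating out the sub-Gaussian noise costs a quadratic term with factor `2σ²/β`. What remains of
the loss is still exponentially concave on `[-L, L]`, `L = R + ‖λ*‖₁`, exactly because `β ≥ 2σ² +
2L²` (`lintegral_exp_quadratic_le_one`). When `P` is the posterior after `m` observations, the inner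
integral is `Z_{m+1}/Z_m`. Summing over `m = 0, …, n` telescopes: `n + 1` times the noise level plus
the sum of the risks of the posterior means is at most `-β E log Z_{n+1}`.

In the other direction, Jensen's inequality under any probability `p ≤ K π` bounds `-β E log
Z_{n+1}` by `β log K` plus `n + 1` times the mean loss under `p`. Take for `p` the sparsity prior of
radius `2Mτ` translated to `λ*`. The heavy tails make translation cost only a factor `(1 +
|λ*_j|/τ)⁴` per coordinate, and since the ball of radius `2Mτ` carries half of the untruncated mass,
the change of normalization costs a factor `2`. By symmetry the coordinates of the centered prior
are uncorrelated, with second moments at most `4τ²`, which yields the trace term.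

The noise level cancels between the two bounds. Division by `n + 1` and convexity of the prediction
risk pass from the individual posterior means to their average. -/

lemma measurable_l1norm {M : ℕ} : Measurable (l1norm : (Fin M → ℝ) → ℝ) := by
  unfold l1norm
  fun_prop

lemma measurableSet_l1norm_le {M : ℕ} (r : ℝ) :
    MeasurableSet {v : Fin M → ℝ | l1norm v ≤ r} :=
  measurableSet_le measurable_l1norm measurable_const

lemma l1norm_nonneg {M : ℕ} (v : Fin M → ℝ) : 0 ≤ l1norm v :=
  Finset.sum_nonneg fun _ _ => abs_nonneg _

lemma l1norm_add_le {M : ℕ} (v w : Fin M → ℝ) : l1norm (v + w) ≤ l1norm v + l1norm w := by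
  unfold l1norm
  rw [← Finset.sum_add_distrib]
  exact Finset.sum_le_sum fun j _ => abs_add_le _ _

lemma l1norm_neg {M : ℕ} (v : Fin M → ℝ) : l1norm (-v) = l1norm v := by
  simp [l1norm]

lemma l1norm_sub_le {M : ℕ} (v w : Fin M → ℝ) : l1norm (v - w) ≤ l1norm v + l1norm w := by
  rw [sub_eq_add_neg, ← l1norm_neg w]
  exact l1norm_add_le _ _

lemma abs_apply_le_l1norm {M : ℕ} (v : Fin M → ℝ) (j : Fin M) : |v j| ≤ l1norm v :=
  Finset.single_le_sum (f := fun j => |v j|) (fun _ _ => abs_nonneg _) (Finset.mem_univ j)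

/-! ### The heavy-tailed kernel and its second moment -/

/-- The unnormalized one-dimensional density of the sparsity prior. -/
noncomputable def studentKernel (τ u : ℝ) : ℝ := ((τ ^ 2 + u ^ 2) ^ 2)⁻¹

lemma studentKernel_pos {τ : ℝ} (hτ : 0 < τ) (u : ℝ) : 0 < studentKernel τ u := by
  unfold studentKernel
  positivity

lemma continuous_studentKernel {τ : ℝ} (hτ : 0 < τ) : Continuous (studentKernel τ) := by
  unfold studentKernel
  exact Continuous.inv₀ (by fun_prop) fun u => by positivity

lemma integrable_inv_sq_add_sq {τ : ℝ} (hτ : 0 < τ) :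
    Integrable (fun u : ℝ => (τ ^ 2 + u ^ 2)⁻¹) := by
  have h := (integrable_inv_one_add_sq.comp_mul_left' (inv_ne_zero hτ.ne')).const_mul ((τ ^ 2)⁻¹)
  refine h.congr (Filter.Eventually.of_forall fun u => ?_)
  have : 0 < τ ^ 2 + u ^ 2 := by positivity
  have h1 : 0 < 1 + (τ⁻¹ * u) ^ 2 := by positivity
  simp only
  field_simp

lemma integrable_studentKernel {τ : ℝ} (hτ : 0 < τ) : Integrable (studentKernel τ) := by
  refine ((integrable_inv_sq_add_sq hτ).const_mul ((τ ^ 2)⁻¹)).mono'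
    (continuous_studentKernel hτ).aestronglyMeasurable (Filter.Eventually.of_forall fun u => ?_)
  rw [Real.norm_of_nonneg (studentKernel_pos hτ u).le, studentKernel, sq, mul_inv]
  gcongr
  nlinarith [sq_nonneg u]

lemma integrable_sq_mul_studentKernel {τ : ℝ} (hτ : 0 < τ) :
    Integrable (fun u => u ^ 2 * studentKernel τ u) := by
  refine (integrable_inv_sq_add_sq hτ).mono'
    ((continuous_id.pow 2).mul (continuous_studentKernel hτ)).aestronglyMeasurable
    (Filter.Eventually.of_forall fun u => ?_)
  have h := studentKernel_pos hτ u
  rw [Real.norm_of_nonneg (by positivity), studentKernel]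
  have : 0 < τ ^ 2 + u ^ 2 := by positivity
  field_simp
  nlinarith [sq_pos_of_pos hτ]

/-- The function `u / (τ² + u²)` has derivative `(τ² - u²) / (τ² + u²)²` and vanishes at both ends
of the line, so the integral of this derivative is zero. -/
lemma integral_sq_mul_studentKernel {τ : ℝ} (hτ : 0 < τ) :
    ∫ u, u ^ 2 * studentKernel τ u = τ ^ 2 * ∫ u, studentKernel τ u := by
  have hi1 := (integrable_studentKernel hτ).const_mul (τ ^ 2)
  have hi2 := integrable_sq_mul_studentKernel hτ
  have hder : ∀ u : ℝ, HasDerivAt (fun u : ℝ => u / (τ ^ 2 + u ^ 2))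
      (τ ^ 2 * studentKernel τ u - u ^ 2 * studentKernel τ u) u := fun u => by
    have hp : τ ^ 2 + u ^ 2 ≠ 0 := by positivity
    have h := (hasDerivAt_id u).div ((hasDerivAt_pow 2 u).const_add (τ ^ 2)) hp
    refine h.congr_deriv ?_
    simp only [studentKernel, id]
    field_simp
    push_cast
    ring
  have hbound : ∀ u : ℝ, |u / (τ ^ 2 + u ^ 2)| ≤ |u⁻¹| := fun u => by
    rcases eq_or_ne u 0 with rfl | hu
    · simp
    rw [abs_div, abs_inv, ← one_div, div_le_div_iff₀ (by positivity) (by positivity),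
      abs_of_pos (by positivity : 0 < τ ^ 2 + u ^ 2), abs_mul_abs_self]
    nlinarith [sq_nonneg τ]
  have key := integral_of_hasDerivAt_of_tendsto hder (hi1.sub hi2)
    (squeeze_zero_norm hbound (abs_zero (α := ℝ) ▸ (tendsto_inv_atBot_zero (𝕜 := ℝ)).abs))
    (squeeze_zero_norm hbound (abs_zero (α := ℝ) ▸ (tendsto_inv_atTop_zero (𝕜 := ℝ)).abs))
  rw [integral_sub hi1 hi2, integral_const_mul] at key
  linarith

/-- The unnormalized density of the sparsity prior without the constraint on the `ℓ₁`-norm. -/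
noncomputable def prodKernel {M : ℕ} (τ : ℝ) (w : Fin M → ℝ) : ℝ := ∏ j, studentKernel τ (w j)

lemma prodKernel_pos {M : ℕ} {τ : ℝ} (hτ : 0 < τ) (w : Fin M → ℝ) : 0 < prodKernel τ w :=
  Finset.prod_pos fun _ _ => studentKernel_pos hτ _

lemma continuous_prodKernel {M : ℕ} {τ : ℝ} (hτ : 0 < τ) :
    Continuous (prodKernel τ : (Fin M → ℝ) → ℝ) :=
  continuous_finsetProd _ fun j _ => (continuous_studentKernel hτ).comp (continuous_apply j)

lemma integrable_prodKernel {M : ℕ} {τ : ℝ} (hτ : 0 < τ) :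
    Integrable (prodKernel τ : (Fin M → ℝ) → ℝ) :=
  Integrable.fintype_prod fun _ => integrable_studentKernel hτ

lemma sq_mul_prodKernel {M : ℕ} (τ : ℝ) (j : Fin M) (w : Fin M → ℝ) :
    w j ^ 2 * prodKernel τ w
      = ∏ i, (fun u => (if i = j then u ^ 2 else 1) * studentKernel τ u) (w i) := by
  simp only [Finset.prod_mul_distrib, prodKernel]
  simp

lemma integrable_sq_mul_prodKernel {M : ℕ} {τ : ℝ} (hτ : 0 < τ) (j : Fin M) :
    Integrable (fun w : Fin M → ℝ => w j ^ 2 * prodKernel τ w) := by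
  simp_rw [sq_mul_prodKernel]
  refine Integrable.fintype_prod (μ := fun _ => volume)
    (f := fun i u => (if i = j then u ^ 2 else 1) * studentKernel τ u) fun i => ?_
  by_cases h : i = j
  · simpa [h] using integrable_sq_mul_studentKernel hτ
  · simpa [h] using integrable_studentKernel hτ

lemma integral_sq_mul_prodKernel {M : ℕ} {τ : ℝ} (hτ : 0 < τ) (j : Fin M) :
    ∫ w : Fin M → ℝ, w j ^ 2 * prodKernel τ w = τ ^ 2 * ∫ w : Fin M → ℝ, prodKernel τ w := by
  simp_rw [sq_mul_prodKernel, prodKernel]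
  rw [integral_fintype_prod_volume_eq_prod
      (fun i u => (if i = j then u ^ 2 else 1) * studentKernel τ u),
    integral_fintype_prod_volume_eq_prod (fun _ u => studentKernel τ u)]
  have : ∀ i : Fin M, ∫ u, (if i = j then u ^ 2 else 1) * studentKernel τ u
      = (if i = j then τ ^ 2 else 1) * ∫ u, studentKernel τ u := fun i => by
    by_cases h : i = j
    · simpa [h] using integral_sq_mul_studentKernel hτ
    · simp [h]
  simp_rw [this]
  rw [Finset.prod_mul_distrib]
  simp

lemma integral_prodKernel_pos {M : ℕ} {τ : ℝ} (hτ : 0 < τ) :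
    0 < ∫ w : Fin M → ℝ, prodKernel τ w := by
  rw [integral_pos_iff_support_of_nonneg (fun w => (prodKernel_pos hτ w).le)
    (integrable_prodKernel hτ)]
  have : Function.support (prodKernel τ : (Fin M → ℝ) → ℝ) = Set.univ :=
    Set.eq_univ_of_forall fun w => (prodKernel_pos hτ w).ne'
  rw [this]
  exact Measure.measure_univ_pos.2 (NeZero.ne _)

/-! ### Mass of `ℓ₁`-balls and normalization -/

/-- The normalizing constant of the sparsity prior. -/
noncomputable def priorMass (M : ℕ) (τ r : ℝ) : ℝ := ∫ w in {v : Fin M → ℝ | l1norm v ≤ r}, prodKernel τ w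

lemma priorMass_mono (M : ℕ) {τ r s : ℝ} (hτ : 0 < τ) (h : r ≤ s) :
    priorMass M τ r ≤ priorMass M τ s :=
  setIntegral_mono_set (integrable_prodKernel hτ).integrableOn
    (Filter.Eventually.of_forall fun w => (prodKernel_pos hτ w).le)
    (Filter.Eventually.of_forall fun w (hw : l1norm w ≤ r) => le_trans hw h)

lemma priorMass_le_integral (M : ℕ) {τ : ℝ} (hτ : 0 < τ) (r : ℝ) :
    priorMass M τ r ≤ ∫ w : Fin M → ℝ, prodKernel τ w :=
  setIntegral_le_integral (integrable_prodKernel hτ)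
    (Filter.Eventually.of_forall fun w => (prodKernel_pos hτ w).le)

/-- At least half of the mass of the product kernel lies in the `ℓ₁`-ball of radius `2Mτ`. -/
lemma integral_prodKernel_le {M : ℕ} (hM : 0 < M) {τ : ℝ} (hτ : 0 < τ) :
    ∫ w : Fin M → ℝ, prodKernel τ w ≤ 2 * priorMass M τ (2 * M * τ) := by
  have hMr : (0 : ℝ) < M := by exact_mod_cast hM
  set B := {v : Fin M → ℝ | l1norm v ≤ 2 * M * τ} with hB
  have hBm : MeasurableSet B := measurableSet_l1norm_le _
  have hK := integrable_prodKernel (M := M) hτ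
  have hsplit := integral_add_compl hBm hK
  -- Markov's inequality through `|u| ≤ (τ² + u²) / (2τ)`
  have hint : Integrable (fun w : Fin M → ℝ =>
      (4 * M * τ ^ 2)⁻¹ * ∑ j, (τ ^ 2 * prodKernel τ w + w j ^ 2 * prodKernel τ w)) :=
    (integrable_finsetSum _ fun j _ =>
      (hK.const_mul _).add (integrable_sq_mul_prodKernel hτ j)).const_mul _
  have htail : ∫ w in Bᶜ, prodKernel τ w ≤ (1 / 2) * ∫ w : Fin M → ℝ, prodKernel τ w := by
    calc ∫ w in Bᶜ, prodKernel τ w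
        ≤ ∫ w in Bᶜ, (4 * M * τ ^ 2)⁻¹ *
            ∑ j, (τ ^ 2 * prodKernel τ w + w j ^ 2 * prodKernel τ w) := by
          refine setIntegral_mono_on hK.integrableOn hint.integrableOn hBm.compl fun w hw => ?_
          have hw' : 2 * M * τ < l1norm w := not_le.1 hw
          have h1 : ∀ j, 2 * τ * |w j| ≤ τ ^ 2 + w j ^ 2 := fun j => by
            nlinarith [sq_nonneg (τ - |w j|), sq_abs (w j)]
          have h2 : 2 * τ * l1norm w ≤ ∑ j, (τ ^ 2 + w j ^ 2) := by
            rw [l1norm, Finset.mul_sum]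
            exact Finset.sum_le_sum fun j _ => h1 j
          -- The radius `2Mτ` is chosen for this threshold: under the normalized kernel the sum on
          -- the right has mean `2Mτ²`, half of `4Mτ²`, so Markov leaves at most half of the mass
          -- outside.
          have h3 : 4 * M * τ ^ 2 ≤ ∑ j, (τ ^ 2 + w j ^ 2) := by nlinarith
          simp_rw [← add_mul]
          rw [← Finset.sum_mul, ← mul_assoc]
          refine le_mul_of_one_le_left (prodKernel_pos hτ w).le ?_
          rw [inv_mul_eq_div, one_le_div (by positivity)]
          exact h3
      _ ≤ ∫ w : Fin M → ℝ, (4 * M * τ ^ 2)⁻¹ *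
            ∑ j, (τ ^ 2 * prodKernel τ w + w j ^ 2 * prodKernel τ w) := by
          refine setIntegral_le_integral hint (Filter.Eventually.of_forall fun w => ?_)
          have := prodKernel_pos hτ w
          simp only [Pi.zero_apply]
          positivity
      _ = (1 / 2) * ∫ w : Fin M → ℝ, prodKernel τ w := by
          rw [integral_const_mul, integral_finsetSum (f := fun j (w : Fin M → ℝ) =>
            τ ^ 2 * prodKernel τ w + w j ^ 2 * prodKernel τ w) _ fun j _ =>
            (hK.const_mul _).add (integrable_sq_mul_prodKernel hτ j)]
          have : ∀ j : Fin M, ∫ w : Fin M → ℝ, (τ ^ 2 * prodKernel τ w + w j ^ 2 * prodKernel τ w)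
              = 2 * τ ^ 2 * ∫ w : Fin M → ℝ, prodKernel τ w := fun j => by
            rw [integral_add (hK.const_mul _) (integrable_sq_mul_prodKernel hτ j),
              integral_const_mul, integral_sq_mul_prodKernel hτ]
            ring
          simp_rw [this]
          rw [Finset.sum_const, Finset.card_univ, Fintype.card_fin, nsmul_eq_mul]
          field_simp
          ring
  have : priorMass M τ (2 * M * τ) = ∫ w in B, prodKernel τ w := rfl
  linarith

lemma priorMass_pos {M : ℕ} (hM : 0 < M) {τ r : ℝ} (hτ : 0 < τ) (hr : 2 * M * τ ≤ r) :
    0 < priorMass M τ r := by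
  have h1 := integral_prodKernel_le hM hτ
  have h2 := integral_prodKernel_pos (M := M) hτ
  have h3 := priorMass_mono M hτ hr
  linarith

lemma sparsityWeight_eq {M : ℕ} (τ r : ℝ) (w : Fin M → ℝ) :
    sparsityWeight τ r w = {v : Fin M → ℝ | l1norm v ≤ r}.indicator
      (fun v => ENNReal.ofReal (prodKernel τ v)) w := rfl

lemma measurable_sparsityWeight {M : ℕ} {τ : ℝ} (hτ : 0 < τ) (r : ℝ) :
    Measurable (sparsityWeight τ r : (Fin M → ℝ) → ℝ≥0∞) :=
  (continuous_prodKernel hτ).measurable.ennreal_ofReal.indicator (measurableSet_l1norm_le r)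

lemma lintegral_sparsityWeight {M : ℕ} {τ : ℝ} (hτ : 0 < τ) (r : ℝ) :
    ∫⁻ v : Fin M → ℝ, sparsityWeight τ r v = ENNReal.ofReal (priorMass M τ r) := by
  simp_rw [sparsityWeight_eq]
  rw [lintegral_indicator (measurableSet_l1norm_le r), priorMass,
    ofReal_integral_eq_lintegral_ofReal (integrable_prodKernel hτ).integrableOn
      (Filter.Eventually.of_forall fun w => (prodKernel_pos hτ w).le)]

lemma isProbabilityMeasure_sparsityPrior {M : ℕ} (hM : 0 < M) {τ r : ℝ} (hτ : 0 < τ)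
    (hr : 2 * M * τ ≤ r) : IsProbabilityMeasure (sparsityPrior M τ r) := by
  constructor
  rw [sparsityPrior, Measure.smul_apply, withDensity_apply _ MeasurableSet.univ,
    Measure.restrict_univ, smul_eq_mul, lintegral_sparsityWeight hτ]
  exact ENNReal.inv_mul_cancel (by simpa using priorMass_pos hM hτ hr) ENNReal.ofReal_ne_top

lemma ae_sparsityPrior {M : ℕ} {τ : ℝ} (hτ : 0 < τ) (r : ℝ) :
    ∀ᵐ w ∂(sparsityPrior M τ r), l1norm w ≤ r := by
  refine Measure.ae_smul_measure ?_ _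
  rw [ae_withDensity_iff (measurable_sparsityWeight hτ r)]
  refine Filter.Eventually.of_forall fun w hw => ?_
  by_contra h
  exact hw (Set.indicator_of_notMem (by simpa using h) _)

lemma integral_sparsityPrior {M : ℕ} {τ : ℝ} (hτ : 0 < τ) (r : ℝ) (g : (Fin M → ℝ) → ℝ) :
    ∫ w, g w ∂(sparsityPrior M τ r)
      = (priorMass M τ r)⁻¹ * ∫ w in {v : Fin M → ℝ | l1norm v ≤ r}, g w * prodKernel τ w := by
  have hfin : ∀ w : Fin M → ℝ, sparsityWeight τ r w < ⊤ := fun w => by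
    rw [sparsityWeight_eq]
    by_cases h : w ∈ {v : Fin M → ℝ | l1norm v ≤ r} <;> simp [h]
  have hmass : 0 ≤ priorMass M τ r := integral_nonneg fun w => (prodKernel_pos hτ w).le
  rw [sparsityPrior, integral_smul_measure, lintegral_sparsityWeight hτ,
    integral_withDensity_eq_integral_toReal_smul (measurable_sparsityWeight hτ r)
      (Filter.Eventually.of_forall hfin), ENNReal.toReal_inv, ENNReal.toReal_ofReal hmass,
    smul_eq_mul, ← integral_indicator (measurableSet_l1norm_le r)]
  congr 2 with w
  rw [sparsityWeight_eq]
  by_cases h : w ∈ {v : Fin M → ℝ | l1norm v ≤ r}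
  · simp only [Set.indicator_of_mem h, smul_eq_mul]
    rw [ENNReal.toReal_ofReal (prodKernel_pos hτ w).le, mul_comm]
  · simp [Set.indicator_of_notMem h]

lemma integral_sq_sparsityPrior_le {M : ℕ} (hM : 0 < M) {τ : ℝ} (hτ : 0 < τ) (j : Fin M) :
    ∫ w, w j ^ 2 ∂(sparsityPrior M τ (2 * M * τ)) ≤ 4 * τ ^ 2 := by
  have hp := priorMass_pos hM hτ le_rfl
  rw [integral_sparsityPrior hτ, inv_mul_le_iff₀ hp]
  calc ∫ w in {v : Fin M → ℝ | l1norm v ≤ 2 * M * τ}, w j ^ 2 * prodKernel τ w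
      ≤ ∫ w : Fin M → ℝ, w j ^ 2 * prodKernel τ w :=
        setIntegral_le_integral (integrable_sq_mul_prodKernel hτ j)
          (Filter.Eventually.of_forall fun w =>
            mul_nonneg (sq_nonneg _) (prodKernel_pos hτ w).le)
    _ = τ ^ 2 * ∫ w : Fin M → ℝ, prodKernel τ w := integral_sq_mul_prodKernel hτ j
    _ ≤ τ ^ 2 * (2 * priorMass M τ (2 * M * τ)) := by
        gcongr
        exact integral_prodKernel_le hM hτ
    -- The preceding bound gives `2τ²`; the factor `4` is slack.
    _ ≤ priorMass M τ (2 * M * τ) * (4 * τ ^ 2) := by nlinarith [sq_pos_of_pos hτ]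

/-- The prior is invariant under the reflection of the `j`-th coordinate, which changes the sign of
`w j * w k`. This makes the quadratic risk of the centered prior collapse to the diagonal of `Σ_X`.
-/
lemma integral_mul_sparsityPrior_eq_zero {M : ℕ} {τ : ℝ} (hτ : 0 < τ) (r : ℝ) {j k : Fin M}
    (hjk : j ≠ k) : ∫ w, w j * w k ∂(sparsityPrior M τ r) = 0 := by
  rw [integral_sparsityPrior hτ, ← integral_indicator (measurableSet_l1norm_le r)]
  set f : (Fin M → ℝ) → ℝ := {v : Fin M → ℝ | l1norm v ≤ r}.indicator
    fun w => w j * w k * prodKernel τ w with hf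
  have hfm : Measurable f :=
    (((measurable_pi_apply j).mul (measurable_pi_apply k)).mul
      (continuous_prodKernel hτ).measurable).indicator (measurableSet_l1norm_le r)
  let φ : (Fin M → ℝ) → Fin M → ℝ := fun w i => (if i = j then Neg.neg else id) (w i)
  have hφ : MeasurePreserving φ volume volume := by
    refine volume_preserving_pi fun i => ?_
    split_ifs
    · exact Measure.measurePreserving_neg volume
    · exact MeasurePreserving.id volume
  have hneg : ∀ w, f (φ w) = - f w := fun w => by
    have h1 : l1norm (φ w) = l1norm w := by
      unfold l1norm
      refine Finset.sum_congr rfl fun i _ => ?_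
      by_cases h : i = j <;> simp [φ, h]
    have h2 : prodKernel τ (φ w) = prodKernel τ w := by
      unfold prodKernel
      refine Finset.prod_congr rfl fun i _ => ?_
      by_cases h : i = j <;> simp [φ, h, studentKernel]
    have h3 : φ w j = - w j := by simp [φ]
    have h4 : φ w k = w k := by simp [φ, hjk.symm]
    simp only [hf, Set.indicator, Set.mem_ofPred_eq, h1, h2, h3, h4]
    split_ifs <;> ring
  have h := integral_map hφ.measurable.aemeasurable
    (hfm.aestronglyMeasurable (μ := volume.map φ))
  rw [hφ.map_eq] at h
  simp_rw [hneg] at h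
  rw [integral_neg] at h
  have h0 : ∫ w, f w = 0 := by linarith
  rw [h0, mul_zero]

/-! ### Cost of translating the prior -/

/-- Polynomial tails make the cost of a shift independent of `u`. With `s = |a|/τ` and `v = u - a`,
the ratio of `τ² + u²` to `τ² + v²` is at most `(1 + s)²`, since `2|v|τ ≤ τ² + v²`; the kernel
squares this. The sum of the logarithms of these factors is the sparsity penalty. -/
lemma studentKernel_sub_le {τ : ℝ} (hτ : 0 < τ) (u a : ℝ) :
    studentKernel τ (u - a) ≤ (1 + |a| / τ) ^ 4 * studentKernel τ u := by
  have h1 : 0 < τ ^ 2 + (u - a) ^ 2 := by positivity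
  have h2 : 0 < τ ^ 2 + u ^ 2 := by positivity
  have key : τ ^ 2 + u ^ 2 ≤ (1 + |a| / τ) ^ 2 * (τ ^ 2 + (u - a) ^ 2) := by
    set s := |a| / τ with hs
    have hs0 : 0 ≤ s := by positivity
    have ha : |a| = s * τ := by rw [hs]; field_simp
    set v := u - a with hv
    have hu : u = v + a := by rw [hv]; ring
    have h3 : v * a ≤ |v| * |a| := by rw [← abs_mul]; exact le_abs_self _
    have h4 : a ^ 2 = (s * τ) ^ 2 := by rw [← ha, sq_abs]
    have h5 : |v| ^ 2 = v ^ 2 := sq_abs v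
    rw [ha] at h3
    rw [hu]
    nlinarith [mul_nonneg hs0 (sq_nonneg (τ - |v|)), mul_nonneg hs0 (sq_nonneg v),
      mul_nonneg (mul_nonneg hs0 hs0) (sq_nonneg v)]
  unfold studentKernel
  rw [← div_eq_mul_inv, le_div_iff₀ (by positivity), inv_mul_le_iff₀ (by positivity)]
  calc (τ ^ 2 + u ^ 2) ^ 2 ≤ ((1 + |a| / τ) ^ 2 * (τ ^ 2 + (u - a) ^ 2)) ^ 2 := by gcongr
    _ = _ := by ring

lemma sparsityWeight_sub_le {M : ℕ} {τ r s : ℝ} (hτ : 0 < τ) (a : Fin M → ℝ)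
    (h : r + l1norm a ≤ s) (w : Fin M → ℝ) :
    sparsityWeight τ r (w - a)
      ≤ ENNReal.ofReal (∏ j, (1 + |a j| / τ) ^ 4) * sparsityWeight τ s w := by
  rw [sparsityWeight_eq, sparsityWeight_eq]
  by_cases hw : l1norm (w - a) ≤ r
  · have hw' : l1norm w ≤ s := by
      have := l1norm_add_le (w - a) a
      rw [sub_add_cancel] at this
      linarith
    rw [Set.indicator_of_mem (by simpa using hw), Set.indicator_of_mem (by simpa using hw'),
      ← ENNReal.ofReal_mul (by positivity)]
    refine ENNReal.ofReal_le_ofReal ?_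
    unfold prodKernel
    rw [← Finset.prod_mul_distrib]
    exact Finset.prod_le_prod (fun j _ => (studentKernel_pos hτ _).le)
      fun j _ => studentKernel_sub_le hτ _ _
  · rw [Set.indicator_of_notMem (by simpa using hw)]
    exact bot_le

/-- The translate to `a` of the sparsity prior with radius `2Mτ` is dominated by a multiple of
the sparsity prior. -/
lemma map_add_sparsityPrior_le {M : ℕ} (hM : 0 < M) {τ R : ℝ} (hτ : 0 < τ) (a : Fin M → ℝ)
    (h : l1norm a ≤ R - 2 * M * τ) :
    (sparsityPrior M τ (2 * M * τ)).map (fun w => w + a)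
      ≤ ENNReal.ofReal (2 * ∏ j, (1 + |a j| / τ) ^ 4) • sparsityPrior M τ R := by
  have hR : 2 * M * τ ≤ R := by linarith [l1norm_nonneg a]
  have hp := priorMass_pos hM hτ hR
  have hp' := priorMass_pos hM hτ (le_refl (2 * M * τ))
  refine Measure.le_iff.2 fun s hs => ?_
  have hadd : Measurable fun w : Fin M → ℝ => w + a := measurable_id.add_const a
  have hs' := hadd hs
  have e1 : ∫⁻ w in (fun w => w + a) ⁻¹' s, sparsityWeight τ (2 * M * τ) w
      = ∫⁻ w in s, sparsityWeight τ (2 * M * τ) (w - a) := by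
    rw [← lintegral_indicator hs', ← lintegral_indicator hs,
      ← lintegral_add_right_eq_self
        (fun w => s.indicator (fun w => sparsityWeight τ (2 * M * τ) (w - a)) w) a]
    refine lintegral_congr fun w => ?_
    simp only [Set.indicator, add_sub_cancel_right]
    rfl
  rw [Measure.map_apply hadd hs, sparsityPrior, sparsityPrior, Measure.smul_apply,
    Measure.smul_apply, Measure.smul_apply, withDensity_apply _ hs', withDensity_apply _ hs, e1,
    lintegral_sparsityWeight hτ, lintegral_sparsityWeight hτ, smul_eq_mul, smul_eq_mul,
    smul_eq_mul]
  have e2 : ∫⁻ w in s, sparsityWeight τ (2 * M * τ) (w - a)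
      ≤ ENNReal.ofReal (∏ j, (1 + |a j| / τ) ^ 4) * ∫⁻ w in s, sparsityWeight τ R w := by
    rw [← lintegral_const_mul _ (measurable_sparsityWeight hτ R)]
    exact lintegral_mono fun w => sparsityWeight_sub_le hτ a (by linarith) w
  -- The mass at radius `R` is at most the full integral, hence at most twice the mass at radius
  -- `2Mτ`. This is the factor `2` in the domination constant.
  have e3 : (ENNReal.ofReal (priorMass M τ (2 * M * τ)))⁻¹
      ≤ ENNReal.ofReal 2 * (ENNReal.ofReal (priorMass M τ R))⁻¹ := by
    rw [← ENNReal.ofReal_inv_of_pos hp, ← ENNReal.ofReal_inv_of_pos hp',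
      ← ENNReal.ofReal_mul (by norm_num)]
    refine ENNReal.ofReal_le_ofReal ?_
    rw [← div_eq_mul_inv, le_div_iff₀ hp, inv_mul_le_iff₀ hp']
    have h1 := priorMass_le_integral M hτ R
    have h2 := integral_prodKernel_le hM hτ
    linarith
  calc _ ≤ (ENNReal.ofReal 2 * (ENNReal.ofReal (priorMass M τ R))⁻¹)
        * (ENNReal.ofReal (∏ j, (1 + |a j| / τ) ^ 4) * ∫⁻ w in s, sparsityWeight τ R w) :=
        mul_le_mul' e3 e2
    _ = _ := by
        rw [ENNReal.ofReal_mul (by norm_num)]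
        ring

/-! ### Linear regression with sub-Gaussian noise -/

/-- The residual of the parameter `lam` at the observation `z`. -/
def resid {M : ℕ} (lam : Fin M → ℝ) (z : (Fin M → ℝ) × ℝ) : ℝ := z.2 - z.1 ⬝ᵥ lam

/-- The second moment of the prediction `X ⬝ᵥ v`. -/
noncomputable def predRisk {M : ℕ} (ν : Measure ((Fin M → ℝ) × ℝ)) (v : Fin M → ℝ) : ℝ :=
  ∫ z, (z.1 ⬝ᵥ v) ^ 2 ∂ν

/-- A law of `(X, Y)` with `X ∈ [-1, 1] ^ M` whose noise `Y - X ⬝ᵥ lamStar` is conditionally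
sub-Gaussian with parameter `σ`. -/
structure IsSubGaussianModel {M : ℕ} (ν : Measure ((Fin M → ℝ) × ℝ)) (lamStar : Fin M → ℝ)
    (σ : ℝ) : Prop where
  abs_le_one : ∀ᵐ z ∂ν, ∀ j, |z.1 j| ≤ 1
  integrable_exp : ∀ t : ℝ, Integrable (fun z => Real.exp (t * resid lamStar z)) ν
  -- The exponent must be allowed to depend on the regressor: in the one-step inequality the noise
  -- is multiplied by a difference of two predictions. As a `lintegral`, the bound needs no
  -- integrability of either side.
  lintegral_exp_le : ∀ g T : (Fin M → ℝ) → ℝ, Measurable g → Measurable T →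
    ∫⁻ z, ENNReal.ofReal (Real.exp (g z.1 + T z.1 * resid lamStar z)) ∂ν
      ≤ ∫⁻ z, ENNReal.ofReal (Real.exp (g z.1 + σ ^ 2 * T z.1 ^ 2 / 2)) ∂ν

section

variable {M : ℕ}

lemma measurable_uncurry_resid :
    Measurable fun p : ((Fin M → ℝ) × ℝ) × (Fin M → ℝ) => resid p.2 p.1 := by
  unfold resid dotProduct
  fun_prop

lemma measurable_resid (lam : Fin M → ℝ) : Measurable (resid lam) :=
  measurable_uncurry_resid.comp (measurable_id.prodMk measurable_const)

lemma measurable_dotProduct_left (v : Fin M → ℝ) : Measurable fun x : Fin M → ℝ => x ⬝ᵥ v := by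
  unfold dotProduct
  fun_prop

lemma measurable_dotProduct_right (x : Fin M → ℝ) : Measurable fun v : Fin M → ℝ => x ⬝ᵥ v := by
  unfold dotProduct
  fun_prop

lemma abs_dotProduct_le_l1norm {x : Fin M → ℝ} (hx : ∀ j, |x j| ≤ 1) (v : Fin M → ℝ) :
    |x ⬝ᵥ v| ≤ l1norm v := by
  unfold dotProduct l1norm
  refine (Finset.abs_sum_le_sum_abs _ _).trans (Finset.sum_le_sum fun j _ => ?_)
  rw [abs_mul]
  exact mul_le_of_le_one_left (abs_nonneg _) (hx j)

lemma resid_eq (lam lamStar : Fin M → ℝ) (z : (Fin M → ℝ) × ℝ) :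
    resid lam z = resid lamStar z + z.1 ⬝ᵥ (lamStar - lam) := by
  simp only [resid, dotProduct_sub]
  ring

lemma abs_dotProduct_sub_le {R : ℝ} {lam lamStar x : Fin M → ℝ} (hx : ∀ j, |x j| ≤ 1)
    (hlam : l1norm lam ≤ R) : |x ⬝ᵥ (lamStar - lam)| ≤ R + l1norm lamStar :=
  (abs_dotProduct_le_l1norm hx _).trans ((l1norm_sub_le _ _).trans (by linarith))

lemma resid_sq_le {R : ℝ} {lam lamStar : Fin M → ℝ} {z : (Fin M → ℝ) × ℝ}
    (hz : ∀ j, |z.1 j| ≤ 1) (hlam : l1norm lam ≤ R) :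
    resid lam z ^ 2 ≤ 2 * resid lamStar z ^ 2 + 2 * (R + l1norm lamStar) ^ 2 := by
  have h1 := sq_le_sq' (by linarith [abs_le.1 (abs_dotProduct_sub_le (lamStar := lamStar) hz hlam)])
    (le_of_abs_le (abs_dotProduct_sub_le (lamStar := lamStar) hz hlam))
  rw [resid_eq lam lamStar]
  nlinarith [sq_nonneg (resid lamStar z - z.1 ⬝ᵥ (lamStar - lam))]

lemma l1norm_integral_le {R : ℝ} {P : Measure (Fin M → ℝ)} [IsProbabilityMeasure P]
    (hP : ∀ᵐ lam ∂P, l1norm lam ≤ R) : l1norm (fun j => ∫ lam, lam j ∂P) ≤ R := by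
  have hint : ∀ j : Fin M, Integrable (fun lam : Fin M → ℝ => |lam j|) P := fun j =>
    Integrable.of_bound (measurable_pi_apply j).abs.aestronglyMeasurable R <| by
      filter_upwards [hP] with lam h
      rw [Real.norm_eq_abs, abs_abs]
      exact (abs_apply_le_l1norm _ _).trans h
  calc l1norm (fun j => ∫ lam, lam j ∂P) ≤ ∑ j, ∫ lam, |lam j| ∂P :=
        Finset.sum_le_sum fun j _ => abs_integral_le_integral_abs
    _ = ∫ lam, l1norm lam ∂P := (integral_finsetSum _ fun j _ => hint j).symm
    _ ≤ ∫ _, R ∂P := integral_mono_ae (integrable_finsetSum _ fun j _ => hint j)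
        (integrable_const _) hP
    _ = R := by simp

lemma integrable_apply_of_l1norm_le {R : ℝ} {P : Measure (Fin M → ℝ)} [IsFiniteMeasure P]
    (hP : ∀ᵐ lam ∂P, l1norm lam ≤ R) (j : Fin M) : Integrable (fun lam => lam j) P :=
  Integrable.of_bound (measurable_pi_apply j).aestronglyMeasurable R <| by
    filter_upwards [hP] with lam h
    exact (abs_apply_le_l1norm _ _).trans h

lemma integral_dotProduct_sub {R : ℝ} {P : Measure (Fin M → ℝ)} [IsProbabilityMeasure P]
    (hP : ∀ᵐ lam ∂P, l1norm lam ≤ R) (x v : Fin M → ℝ) :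
    ∫ lam, x ⬝ᵥ (v - lam) ∂P = x ⬝ᵥ (v - fun j => ∫ lam, lam j ∂P) := by
  have hint := integrable_apply_of_l1norm_le hP
  simp only [dotProduct, Pi.sub_apply]
  have hi : ∀ j, Integrable (fun lam : Fin M → ℝ => x j * (v j - lam j)) P := fun j =>
    ((integrable_const (v j)).sub (hint j)).const_mul (x j)
  rw [integral_finsetSum _ fun j _ => hi j]
  refine Finset.sum_congr rfl fun j _ => ?_
  rw [integral_const_mul, integral_sub (integrable_const _) (hint j)]
  simp

/-- The difference of the two sides is minimal at `t = 0`, where its derivative is `-a`. This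
extracts a vanishing first moment from a sub-Gaussian bound. -/
lemma eq_zero_of_forall_one_add_mul_le {a c : ℝ} (h : ∀ t : ℝ, 1 + t * a ≤ Real.exp (c * t ^ 2)) :
    a = 0 := by
  have hmin : IsLocalMin (fun t : ℝ => Real.exp (c * t ^ 2) - t * a) 0 :=
    Filter.Eventually.of_forall fun t => by
      have := h t
      simp only [ne_eq, OfNat.ofNat_ne_zero, not_false_eq_true, zero_pow, mul_zero, Real.exp_zero,
        zero_mul, sub_zero]
      linarith
  have hder : HasDerivAt (fun t : ℝ => Real.exp (c * t ^ 2) - t * a) (-a) 0 := by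
    have h1 := (((hasDerivAt_pow 2 (0 : ℝ)).const_mul c).exp).sub
      ((hasDerivAt_id (0 : ℝ)).mul_const a)
    refine h1.congr_deriv ?_
    simp
  have := hmin.hasDerivAt_eq_zero hder
  linarith

/-- The integrated form of the exponential concavity of the quadratic loss. -/
lemma lintegral_exp_quadratic_le_one {Λ : Type*} [MeasurableSpace Λ] {P : Measure Λ}
    [IsProbabilityMeasure P] {u : Λ → ℝ} (hu : Measurable u) {L s β : ℝ} (hβ : 0 < β)
    (hs0 : 0 ≤ s) (hs1 : s ≤ 1) (hLs : 2 * L ^ 2 ≤ (1 - s) * β) (huL : ∀ᵐ l ∂P, |u l| ≤ L)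
    {m : ℝ} (hm : ∫ l, u l ∂P = m) :
    ∫⁻ l, ENNReal.ofReal (Real.exp ((m ^ 2 - u l ^ 2 + s * (m - u l) ^ 2) / β)) ∂P ≤ 1 := by
  have huint : Integrable u P := Integrable.of_bound hu.aestronglyMeasurable L huL
  have hmL : |m| ≤ L := by
    rw [← hm]
    refine abs_integral_le_integral_abs.trans ?_
    calc ∫ l, |u l| ∂P ≤ ∫ _, L ∂P := integral_mono_ae huint.abs (integrable_const _) huL
      _ = L := by simp
  set φ : ℝ → ℝ := fun v => Real.exp ((m ^ 2 - v ^ 2 + s * (m - v) ^ 2) / β) with hφ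
  set h' : ℝ → ℝ := fun v => (-2 * v - 2 * s * (m - v)) / β with hh'
  have hφc : Continuous φ := by
    rw [hφ]
    fun_prop
  have hd0 : ∀ v, HasDerivAt (fun v => (m ^ 2 - v ^ 2 + s * (m - v) ^ 2) / β) (h' v) v :=
    fun v => by
    have e := ((((hasDerivAt_id v).pow 2).const_sub (m ^ 2)).add
      ((((hasDerivAt_id v).const_sub m).pow 2).const_mul s)).div_const β
    refine e.congr_deriv ?_
    simp only [hh', id]
    push_cast
    ring
  have hd1 : ∀ v, HasDerivAt φ (φ v * h' v) v := fun v => (hd0 v).exp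
  have hd2 : ∀ v, HasDerivAt (fun v => φ v * h' v)
      (φ v * h' v * h' v + φ v * ((-2 + 2 * s) / β)) v := fun v => by
    refine (hd1 v).mul ?_
    have e := (((hasDerivAt_id v).const_mul (-2)).sub
      (((hasDerivAt_id v).const_sub m).const_mul (2 * s))).div_const β
    refine e.congr_deriv ?_
    ring
  -- The sign of `φ''` is that of `4((1 - s)v + sm)² - 2(1 - s)β`. The squared term is a convex
  -- combination of points of `[-L, L]`, so `hLs` suffices. Jensen then compares the integral with
  -- `φ m = 1`.
  have hconc : ConcaveOn ℝ (Set.Icc (-L) L) φ := by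
    refine concaveOn_of_hasDerivWithinAt2_nonpos (convex_Icc _ _) hφc.continuousOn
      (fun v _ => (hd1 v).hasDerivWithinAt) (fun v _ => (hd2 v).hasDerivWithinAt) fun v hv => ?_
    have hv' : |v| ≤ L := abs_le.2 (Set.mem_Icc.1 (interior_subset hv))
    have hle : |(1 - s) * v + s * m| ≤ L := by
      refine (abs_add_le _ _).trans ?_
      rw [abs_mul, abs_mul, abs_of_nonneg hs0, abs_of_nonneg (sub_nonneg.2 hs1)]
      nlinarith
    have hsq : ((1 - s) * v + s * m) ^ 2 ≤ L ^ 2 :=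
      sq_le_sq' (by linarith [abs_le.1 hle]) (le_of_abs_le hle)
    have e1 : φ v * h' v * h' v + φ v * ((-2 + 2 * s) / β)
        = φ v * ((4 * ((1 - s) * v + s * m) ^ 2 - 2 * ((1 - s) * β)) / β ^ 2) := by
      simp only [hh']
      field_simp
      ring
    rw [e1]
    refine mul_nonpos_of_nonneg_of_nonpos (Real.exp_pos _).le
      (div_nonpos_of_nonpos_of_nonneg ?_ (by positivity))
    linarith
  have hφint : Integrable (fun l => φ (u l)) P := by
    refine Integrable.of_bound (hφc.measurable.comp hu).aestronglyMeasurable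
      (Real.exp ((L ^ 2 + s * (2 * L) ^ 2) / β)) ?_
    filter_upwards [huL] with l hl
    rw [Real.norm_of_nonneg (Real.exp_pos _).le]
    refine Real.exp_le_exp.2 ?_
    have h1 : m ^ 2 ≤ L ^ 2 := sq_le_sq' (by linarith [abs_le.1 hmL]) (le_of_abs_le hmL)
    have h2 : (m - u l) ^ 2 ≤ (2 * L) ^ 2 :=
      sq_le_sq' (by linarith [abs_le.1 hmL, abs_le.1 hl]) (by linarith [abs_le.1 hmL, abs_le.1 hl])
    gcongr
    linarith [sq_nonneg (u l)]
  have hJ := hconc.le_map_integral hφc.continuousOn isClosed_Icc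
    (huL.mono fun l hl => abs_le.1 hl) huint hφint
  rw [hm] at hJ
  have hφm : φ m = 1 := by simp [hφ]
  rw [hφm] at hJ
  rw [← ofReal_integral_eq_lintegral_ofReal hφint
    (Filter.Eventually.of_forall fun l => (Real.exp_pos _).le)]
  exact ENNReal.ofReal_le_one.2 hJ

namespace IsSubGaussianModel

variable {ν : Measure ((Fin M → ℝ) × ℝ)} {lamStar : Fin M → ℝ} {σ : ℝ}

lemma integrable_sq (hν : IsSubGaussianModel ν lamStar σ) :
    Integrable (fun z => resid lamStar z ^ 2) ν := by
  refine (((hν.integrable_exp 1).add (hν.integrable_exp (-1))).const_mul 2).mono'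
    ((measurable_resid _).pow_const 2).aestronglyMeasurable
    (Filter.Eventually.of_forall fun z => ?_)
  rw [Real.norm_of_nonneg (sq_nonneg _)]
  set x := resid lamStar z
  have h := Real.quadratic_le_exp_of_nonneg (abs_nonneg x)
  have h2 : Real.exp |x| ≤ Real.exp x + Real.exp (-x) := by
    rcases abs_cases x with ⟨h, _⟩ | ⟨h, _⟩ <;> rw [h] <;>
      linarith [Real.exp_pos x, Real.exp_pos (-x)]
  simp only [Pi.add_apply, one_mul, neg_mul]
  nlinarith [abs_nonneg x, sq_abs x]

lemma abs_dotProduct_le (hν : IsSubGaussianModel ν lamStar σ) (v : Fin M → ℝ) :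
    ∀ᵐ z ∂ν, |z.1 ⬝ᵥ v| ≤ l1norm v :=
  hν.abs_le_one.mono fun _ hz => abs_dotProduct_le_l1norm hz v

variable [IsProbabilityMeasure ν]

lemma integrable_resid (hν : IsSubGaussianModel ν lamStar σ) :
    Integrable (fun z => resid lamStar z) ν := by
  refine ((integrable_const (1 : ℝ)).add hν.integrable_sq).mono'
    (measurable_resid _).aestronglyMeasurable (Filter.Eventually.of_forall fun z => ?_)
  rw [Real.norm_eq_abs]
  simp only [Pi.add_apply]
  nlinarith [sq_abs (resid lamStar z), sq_nonneg (|resid lamStar z| - 1)]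

lemma integrable_mul_resid (hν : IsSubGaussianModel ν lamStar σ) {f : (Fin M → ℝ) → ℝ}
    (hf : Measurable f) {B : ℝ} (hB : ∀ᵐ z ∂ν, |f z.1| ≤ B) :
    Integrable (fun z => f z.1 * resid lamStar z) ν :=
  hν.integrable_resid.bdd_mul (hf.comp measurable_fst).aestronglyMeasurable hB

/-- The noise is orthogonal to the bounded functions of the regressor. -/
lemma integral_mul_resid (hν : IsSubGaussianModel ν lamStar σ) {f : (Fin M → ℝ) → ℝ}
    (hf : Measurable f) {B : ℝ} (hB : ∀ᵐ z ∂ν, |f z.1| ≤ B) :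
    ∫ z, f z.1 * resid lamStar z ∂ν = 0 := by
  have hint := hν.integrable_mul_resid hf hB
  -- Both bounds pass through `E exp(t f(X) ξ)`: below by `1 + x ≤ exp x`, above by the sub-Gaussian
  -- estimate with exponent `t f(X)`.
  refine eq_zero_of_forall_one_add_mul_le (c := σ ^ 2 * B ^ 2 / 2) fun t => ?_
  have hle : ∫⁻ z, ENNReal.ofReal (Real.exp (t * (f z.1 * resid lamStar z))) ∂ν
      ≤ ENNReal.ofReal (Real.exp (σ ^ 2 * B ^ 2 / 2 * t ^ 2)) := by
    have h := hν.lintegral_exp_le (fun _ => 0) (fun x => t * f x) measurable_const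
      (hf.const_mul t)
    simp only [zero_add, mul_assoc] at h
    refine h.trans ?_
    calc _ ≤ ∫⁻ _, ENNReal.ofReal (Real.exp (σ ^ 2 * B ^ 2 / 2 * t ^ 2)) ∂ν := by
          refine lintegral_mono_ae ?_
          filter_upwards [hB] with z hz
          refine ENNReal.ofReal_le_ofReal (Real.exp_le_exp.2 ?_)
          have hsq : f z.1 ^ 2 ≤ B ^ 2 := sq_le_sq' (by linarith [abs_le.1 hz]) (le_of_abs_le hz)
          have := mul_le_mul_of_nonneg_left hsq (by positivity : 0 ≤ σ ^ 2 * t ^ 2 / 2)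
          linarith
      _ = _ := by simp
  have hexp : Integrable (fun z => Real.exp (t * (f z.1 * resid lamStar z))) ν := by
    refine ⟨(((hf.comp measurable_fst).mul (measurable_resid _)).const_mul t).exp.aestronglyMeasurable,
      ?_⟩
    rw [hasFiniteIntegral_iff_ofReal (Filter.Eventually.of_forall fun z => (Real.exp_pos _).le)]
    exact hle.trans_lt ENNReal.ofReal_lt_top
  rw [← ofReal_integral_eq_lintegral_ofReal hexp
    (Filter.Eventually.of_forall fun z => (Real.exp_pos _).le),
    ENNReal.ofReal_le_ofReal_iff (Real.exp_pos _).le] at hle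
  refine le_trans ?_ hle
  have hone : (1 : ℝ) + t * ∫ z, f z.1 * resid lamStar z ∂ν
      = ∫ z, (1 + t * (f z.1 * resid lamStar z)) ∂ν := by
    rw [integral_add (integrable_const _) (hint.const_mul t), integral_const_mul]
    simp
  rw [hone]
  refine integral_mono ((integrable_const _).add (hint.const_mul t)) hexp fun z => ?_
  have := Real.add_one_le_exp (t * (f z.1 * resid lamStar z))
  simp only
  linarith

lemma integrable_dotProduct_sq (hν : IsSubGaussianModel ν lamStar σ) (v : Fin M → ℝ) :
    Integrable (fun z => (z.1 ⬝ᵥ v) ^ 2) ν := by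
  refine Integrable.of_bound
    (((measurable_dotProduct_left v).comp measurable_fst).pow_const 2).aestronglyMeasurable
    (l1norm v ^ 2) ?_
  filter_upwards [hν.abs_dotProduct_le v] with z hz
  rw [Real.norm_of_nonneg (sq_nonneg _)]
  exact sq_le_sq' (by linarith [abs_le.1 hz]) (le_of_abs_le hz)

lemma predRisk_le (hν : IsSubGaussianModel ν lamStar σ) (v : Fin M → ℝ) :
    predRisk ν v ≤ l1norm v ^ 2 := by
  calc predRisk ν v ≤ ∫ _, l1norm v ^ 2 ∂ν := by
        refine integral_mono_ae (hν.integrable_dotProduct_sq v) (integrable_const _) ?_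
        filter_upwards [hν.abs_dotProduct_le v] with z hz
        exact sq_le_sq' (by linarith [abs_le.1 hz]) (le_of_abs_le hz)
    _ = l1norm v ^ 2 := by simp

lemma integrable_resid_sq (hν : IsSubGaussianModel ν lamStar σ) (lam : Fin M → ℝ) :
    Integrable (fun z => resid lam z ^ 2) ν := by
  refine ((hν.integrable_sq.const_mul 2).add
    (integrable_const (2 * (l1norm lam + l1norm lamStar) ^ 2))).mono'
    ((measurable_resid _).pow_const 2).aestronglyMeasurable ?_
  filter_upwards [hν.abs_le_one] with z hz
  rw [Real.norm_of_nonneg (sq_nonneg _)]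
  exact resid_sq_le hz le_rfl

/-- Bias-variance decomposition of the prediction error. -/
lemma integral_resid_sq (hν : IsSubGaussianModel ν lamStar σ) (lam : Fin M → ℝ) :
    ∫ z, resid lam z ^ 2 ∂ν = ∫ z, resid lamStar z ^ 2 ∂ν + predRisk ν (lam - lamStar) := by
  have e : ∀ z : (Fin M → ℝ) × ℝ, resid lam z ^ 2 = resid lamStar z ^ 2
      + (z.1 ⬝ᵥ (lam - lamStar)) ^ 2 - 2 * (z.1 ⬝ᵥ (lam - lamStar) * resid lamStar z) := fun z => by
    rw [resid_eq lam lamStar, ← neg_sub lam lamStar, dotProduct_neg]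
    ring
  have hm := measurable_dotProduct_left (lam - lamStar)
  have hb := hν.abs_dotProduct_le (lam - lamStar)
  simp_rw [e]
  have hi : Integrable (fun z : (Fin M → ℝ) × ℝ => resid lamStar z ^ 2
      + (z.1 ⬝ᵥ (lam - lamStar)) ^ 2) ν := hν.integrable_sq.add (hν.integrable_dotProduct_sq _)
  rw [integral_sub hi ((hν.integrable_mul_resid hm hb).const_mul 2),
    integral_add hν.integrable_sq (hν.integrable_dotProduct_sq _), integral_const_mul,
    hν.integral_mul_resid hm hb, predRisk]
  ring

end IsSubGaussianModel

end

/-! ### One step of mirror averaging -/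

section

variable {M : ℕ}

lemma integrable_exp_neg_of_nonneg {Λ : Type*} [MeasurableSpace Λ] {P : Measure Λ}
    [IsFiniteMeasure P] {f : Λ → ℝ} (hf : Measurable f) (h0 : ∀ l, 0 ≤ f l) :
    Integrable (fun l => Real.exp (-f l)) P := by
  refine Integrable.of_bound hf.neg.exp.aestronglyMeasurable 1 (Filter.Eventually.of_forall fun l => ?_)
  rw [Real.norm_of_nonneg (Real.exp_pos _).le, Real.exp_le_one_iff]
  linarith [h0 l]

/-- The integral lies between `exp(-c)` and `1`. With `c` an affine function of squared noise, this
makes all the log-evidences integrable. -/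
lemma abs_log_integral_exp_neg_le {Λ : Type*} [MeasurableSpace Λ] {P : Measure Λ}
    [IsProbabilityMeasure P] {f : Λ → ℝ} (hf : Measurable f) (h0 : ∀ l, 0 ≤ f l) {c : ℝ}
    (hc : ∀ᵐ l ∂P, f l ≤ c) : |Real.log (∫ l, Real.exp (-f l) ∂P)| ≤ c := by
  have hint := integrable_exp_neg_of_nonneg (P := P) hf h0
  have hpos := integral_exp_pos hint
  have hle : ∫ l, Real.exp (-f l) ∂P ≤ 1 := by
    calc ∫ l, Real.exp (-f l) ∂P ≤ ∫ _, (1 : ℝ) ∂P :=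
          integral_mono hint (integrable_const _) fun l => by
            simpa using h0 l
      _ = 1 := by simp
  have hge : Real.exp (-c) ≤ ∫ l, Real.exp (-f l) ∂P := by
    calc Real.exp (-c) = ∫ _, Real.exp (-c) ∂P := by simp
      _ ≤ _ := integral_mono_ae (integrable_const _) hint <| by
          filter_upwards [hc] with l hl
          exact Real.exp_le_exp.2 (by linarith)
  rw [abs_of_nonpos (Real.log_nonpos hpos.le hle)]
  have := (Real.le_log_iff_exp_le hpos).2 hge
  linarith

/-- Being a polynomial in `v` gives measurability of the risk, its identification with the
`Σ_X`-quadratic form, and its integral against the centered prior. -/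
lemma predRisk_eq_sum {ν : Measure ((Fin M → ℝ) × ℝ)} [IsProbabilityMeasure ν]
    (hν : ∀ᵐ z ∂ν, ∀ j, |z.1 j| ≤ 1) (v : Fin M → ℝ) :
    predRisk ν v = ∑ j, ∑ k, v j * v k * ∫ z, z.1 j * z.1 k ∂ν := by
  have hint : ∀ j k, Integrable (fun z : (Fin M → ℝ) × ℝ => v j * v k * (z.1 j * z.1 k)) ν :=
    fun j k => by
    refine Integrable.const_mul (Integrable.of_bound (C := 1) ?_ ?_) _
    · exact Measurable.aestronglyMeasurable (by fun_prop)
    · filter_upwards [hν] with z hz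
      rw [Real.norm_eq_abs, abs_mul]
      exact mul_le_one₀ (hz j) (abs_nonneg _) (hz k)
  have e : ∀ z : (Fin M → ℝ) × ℝ, (z.1 ⬝ᵥ v) ^ 2 = ∑ j, ∑ k, v j * v k * (z.1 j * z.1 k) :=
    fun z => by
    rw [sq, dotProduct, Finset.sum_mul_sum]
    refine Finset.sum_congr rfl fun j _ => Finset.sum_congr rfl fun k _ => ?_
    ring
  unfold predRisk
  simp_rw [e]
  rw [integral_finsetSum _ fun j _ => integrable_finsetSum _ fun k _ => hint j k]
  refine Finset.sum_congr rfl fun j _ => ?_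
  rw [integral_finsetSum _ fun k _ => hint j k]
  exact Finset.sum_congr rfl fun k _ => integral_const_mul _ _

lemma measurable_integral_exp_resid {P : Measure (Fin M → ℝ)} [SFinite P] (β : ℝ) :
    Measurable fun z => ∫ lam, Real.exp (-(1 / β * resid lam z ^ 2)) ∂P := by
  refine (StronglyMeasurable.integral_prod_right
    (f := fun z lam => Real.exp (-(1 / β * resid lam z ^ 2))) ?_).measurable
  exact ((measurable_uncurry_resid.pow_const 2).const_mul _).neg.exp.stronglyMeasurable

variable {ν : Measure ((Fin M → ℝ) × ℝ)} [IsProbabilityMeasure ν] {lamStar : Fin M → ℝ} {σ : ℝ}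

lemma IsSubGaussianModel.integrable_log_integral_exp_resid
    (hν : IsSubGaussianModel ν lamStar σ) {P : Measure (Fin M → ℝ)} [IsProbabilityMeasure P]
    {R β : ℝ} (hP : ∀ᵐ lam ∂P, l1norm lam ≤ R) (hβ : 0 < β) :
    Integrable (fun z => Real.log (∫ lam, Real.exp (-(1 / β * resid lam z ^ 2)) ∂P)) ν := by
  refine (((hν.integrable_sq.const_mul 2).add
    (integrable_const (2 * (R + l1norm lamStar) ^ 2))).const_mul (1 / β)).mono'
    (measurable_integral_exp_resid β).log.aestronglyMeasurable ?_
  filter_upwards [hν.abs_le_one] with z hz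
  rw [Real.norm_eq_abs]
  refine abs_log_integral_exp_neg_le (f := fun lam => 1 / β * resid lam z ^ 2) ?_
    (fun l => by positivity) ?_
  · exact ((measurable_uncurry_resid.comp (measurable_const.prodMk measurable_id)).pow_const
      2).const_mul _
  · filter_upwards [hP] with lam hlam
    exact mul_le_mul_of_nonneg_left (resid_sq_le hz hlam) (by positivity)

/-- The mean of a distribution on the parameters predicts, on average over a new observation, at
least as well as the corresponding exponential mixture. -/
lemma IsSubGaussianModel.predRisk_mean_le
    (hν : IsSubGaussianModel ν lamStar σ) {P : Measure (Fin M → ℝ)} [IsProbabilityMeasure P]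
    {R β : ℝ} (hP : ∀ᵐ lam ∂P, l1norm lam ≤ R) (hβ0 : 0 < β)
    (hβ : 2 * σ ^ 2 + 2 * (R + l1norm lamStar) ^ 2 ≤ β) :
    ∫ z, resid lamStar z ^ 2 ∂ν + predRisk ν ((fun j => ∫ lam, lam j ∂P) - lamStar)
      ≤ -β * ∫ z, Real.log (∫ lam, Real.exp (-(1 / β * resid lam z ^ 2)) ∂P) ∂ν := by
  set m : Fin M → ℝ := fun j => ∫ lam, lam j ∂P with hm
  set W : (Fin M → ℝ) × ℝ → ℝ := fun z => ∫ lam, Real.exp (-(1 / β * resid lam z ^ 2)) ∂P with hW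
  have hWm : Measurable W := measurable_integral_exp_resid β
  have hrm : ∀ z : (Fin M → ℝ) × ℝ, Measurable fun lam => resid lam z := fun z =>
    measurable_uncurry_resid.comp (measurable_const.prodMk measurable_id)
  have hWint : ∀ z, Integrable (fun lam => Real.exp (-(1 / β * resid lam z ^ 2))) P := fun z =>
    integrable_exp_neg_of_nonneg (((hrm z).pow_const 2).const_mul _) fun l => by positivity
  have hWpos : ∀ z, 0 < W z := fun z => integral_exp_pos (hWint z)
  have hlogW : Integrable (fun z => Real.log (W z)) ν :=
    hν.integrable_log_integral_exp_resid hP hβ0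
  set V : (Fin M → ℝ) × ℝ → ℝ := fun z => Real.exp (1 / β * resid m z ^ 2) * W z with hV
  have hVm : Measurable V := (((measurable_resid m).pow_const 2).const_mul _).exp.mul hWm
  have hVpos : ∀ z, 0 < V z := fun z => mul_pos (Real.exp_pos _) (hWpos z)
  -- the exponential moment of the excess loss is at most one
  have hV1 : ∫⁻ z, ENNReal.ofReal (V z) ∂ν ≤ 1 := by
    have e1 : ∀ z, ENNReal.ofReal (V z) = ∫⁻ lam, ENNReal.ofReal (Real.exp
        (((z.1 ⬝ᵥ (lamStar - m)) ^ 2 - (z.1 ⬝ᵥ (lamStar - lam)) ^ 2) / β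
          + 2 * (z.1 ⬝ᵥ (lamStar - m) - z.1 ⬝ᵥ (lamStar - lam)) / β * resid lamStar z)) ∂P := by
      intro z
      simp only [hV, hW]
      rw [← integral_const_mul, ofReal_integral_eq_lintegral_ofReal ((hWint z).const_mul _)
        (Filter.Eventually.of_forall fun l => by positivity)]
      refine lintegral_congr fun lam => ?_
      rw [← Real.exp_add, resid_eq m lamStar, resid_eq lam lamStar]
      congr 2
      field_simp
      ring
    have hdm : Measurable fun p : ((Fin M → ℝ) × ℝ) × (Fin M → ℝ) =>
        p.1.1 ⬝ᵥ (lamStar - p.2) := by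
      unfold dotProduct
      simp only [Pi.sub_apply]
      fun_prop
    have hdm' : Measurable fun p : ((Fin M → ℝ) × ℝ) × (Fin M → ℝ) =>
        p.1.1 ⬝ᵥ (lamStar - m) :=
      (measurable_dotProduct_left _).comp (measurable_fst.comp measurable_fst)
    calc ∫⁻ z, ENNReal.ofReal (V z) ∂ν
        = ∫⁻ lam, ∫⁻ z, ENNReal.ofReal (Real.exp
        (((z.1 ⬝ᵥ (lamStar - m)) ^ 2 - (z.1 ⬝ᵥ (lamStar - lam)) ^ 2) / β
          + 2 * (z.1 ⬝ᵥ (lamStar - m) - z.1 ⬝ᵥ (lamStar - lam)) / β * resid lamStar z)) ∂ν ∂P := by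
          rw [lintegral_congr e1]
          refine lintegral_lintegral_swap (Measurable.aemeasurable ?_)
          exact ((((hdm'.pow_const 2).sub (hdm.pow_const 2)).div_const β).add
            ((((hdm'.sub hdm).const_mul 2).div_const β).mul
              ((measurable_resid lamStar).comp measurable_fst))).exp.ennreal_ofReal
      -- With `lam` fixed by the Tonelli swap, the noise enters linearly in the exponent and can be
      -- integrated out; a second swap then restores the integral over `lam` at a fixed regressor.
      _ ≤ ∫⁻ lam, ∫⁻ z, ENNReal.ofReal (Real.exp
        (((z.1 ⬝ᵥ (lamStar - m)) ^ 2 - (z.1 ⬝ᵥ (lamStar - lam)) ^ 2) / β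
          + σ ^ 2 * (2 * (z.1 ⬝ᵥ (lamStar - m) - z.1 ⬝ᵥ (lamStar - lam)) / β) ^ 2 / 2)) ∂ν ∂P := by
          refine lintegral_mono fun lam => ?_
          have h1 := measurable_dotProduct_left (lamStar - m)
          have h2 := measurable_dotProduct_left (lamStar - lam)
          exact hν.lintegral_exp_le
            (fun x => ((x ⬝ᵥ (lamStar - m)) ^ 2 - (x ⬝ᵥ (lamStar - lam)) ^ 2) / β)
            (fun x => 2 * (x ⬝ᵥ (lamStar - m) - x ⬝ᵥ (lamStar - lam)) / β)
            (((h1.pow_const 2).sub (h2.pow_const 2)).div_const β)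
            (((h1.sub h2).const_mul 2).div_const β)
      _ = ∫⁻ z, ∫⁻ lam, ENNReal.ofReal (Real.exp
        (((z.1 ⬝ᵥ (lamStar - m)) ^ 2 - (z.1 ⬝ᵥ (lamStar - lam)) ^ 2) / β
          + σ ^ 2 * (2 * (z.1 ⬝ᵥ (lamStar - m) - z.1 ⬝ᵥ (lamStar - lam)) / β) ^ 2 / 2)) ∂P ∂ν := by
          refine (lintegral_lintegral_swap (Measurable.aemeasurable ?_)).symm
          exact ((((hdm'.pow_const 2).sub (hdm.pow_const 2)).div_const β).add
            ((((((hdm'.sub hdm).const_mul 2).div_const β).pow_const 2).const_mul _).div_const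
              2)).exp.ennreal_ofReal
      _ ≤ ∫⁻ _, 1 ∂ν := by
          refine lintegral_mono_ae ?_
          filter_upwards [hν.abs_le_one] with z hz
          have hs : 2 * σ ^ 2 / β ≤ 1 := by
            rw [div_le_one hβ0]
            nlinarith [sq_nonneg (R + l1norm lamStar)]
          have hLs : 2 * (R + l1norm lamStar) ^ 2 ≤ (1 - 2 * σ ^ 2 / β) * β := by
            rw [sub_mul, div_mul_cancel₀ _ hβ0.ne']
            linarith
          -- Here `s = 2σ²/β`: the sub-Gaussian term `σ²(2(m - u)/β)²/2` equals `s(m - u)²/β`, and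
          -- `(1 - s)β = β - 2σ²` is at least `2(R + ‖λ*‖₁)²`.
          have h := lintegral_exp_quadratic_le_one (P := P)
            (u := fun lam => z.1 ⬝ᵥ (lamStar - lam))
            ((measurable_dotProduct_right z.1).comp (measurable_const.sub measurable_id))
            hβ0 (by positivity) hs hLs (hP.mono fun lam hlam => abs_dotProduct_sub_le hz hlam)
            (integral_dotProduct_sub hP z.1 lamStar)
          refine le_trans (le_of_eq (lintegral_congr fun lam => ?_)) h
          congr 2
          field_simp
          ring
      _ = 1 := by simp
  have hVint : Integrable V ν := by
    refine ⟨hVm.aestronglyMeasurable, ?_⟩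
    rw [hasFiniteIntegral_iff_ofReal (Filter.Eventually.of_forall fun z => (hVpos z).le)]
    exact hV1.trans_lt ENNReal.one_lt_top
  have hV1' : ∫ z, V z ∂ν ≤ 1 := by
    rwa [← ofReal_integral_eq_lintegral_ofReal hVint
      (Filter.Eventually.of_forall fun z => (hVpos z).le), ENNReal.ofReal_le_one] at hV1
  have hlogV : ∀ z, Real.log (V z) = 1 / β * resid m z ^ 2 + Real.log (W z) := fun z => by
    rw [hV, Real.log_mul (Real.exp_pos _).ne' (hWpos z).ne', Real.log_exp]
  have hres := hν.integrable_resid_sq m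
  -- From `E V ≤ 1` through `log x ≤ x - 1`.
  have hle : ∫ z, Real.log (V z) ∂ν ≤ 0 := by
    calc ∫ z, Real.log (V z) ∂ν ≤ ∫ z, (V z - 1) ∂ν := by
          refine integral_mono ?_ (hVint.sub (integrable_const _)) fun z =>
            Real.log_le_sub_one_of_pos (hVpos z)
          simp_rw [hlogV]
          exact (hres.const_mul _).add hlogW
      _ = ∫ z, V z ∂ν - 1 := by
          rw [integral_sub hVint (integrable_const _)]
          simp
      _ ≤ 0 := by linarith
  simp_rw [hlogV] at hle
  rw [integral_add (hres.const_mul _) hlogW, integral_const_mul, hν.integral_resid_sq m] at hle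
  have h := mul_le_mul_of_nonneg_left hle hβ0.le
  rw [mul_zero, mul_add, ← mul_assoc, mul_one_div_cancel hβ0.ne', one_mul] at h
  linarith

end

/-! ### The sequence of exponentially weighted averages -/

section

variable {M m : ℕ}

/-- The logarithm of the weight of the parameter `lam` given the observations `D`. -/
noncomputable def logWeight (β : ℝ) (D : Fin m → (Fin M → ℝ) × ℝ) (lam : Fin M → ℝ) : ℝ :=
  -(1 / β * ∑ i, resid lam (D i) ^ 2)

/-- The normalizing constant of the posterior distribution given the observations `D`. -/
noncomputable def evidence (π : Measure (Fin M → ℝ)) (β : ℝ) (D : Fin m → (Fin M → ℝ) × ℝ) : ℝ :=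
  ∫ lam, Real.exp (logWeight β D lam) ∂π

/-- The mean of the posterior distribution given the observations `D`. -/
noncomputable def posteriorMean (π : Measure (Fin M → ℝ)) (β : ℝ)
    (D : Fin m → (Fin M → ℝ) × ℝ) : Fin M → ℝ :=
  fun j => ∫ lam, lam j ∂(π.tilted (logWeight β D))

lemma measurable_uncurry_logWeight (β : ℝ) :
    Measurable fun p : (Fin m → (Fin M → ℝ) × ℝ) × (Fin M → ℝ) => logWeight β p.1 p.2 := by
  unfold logWeight
  refine ((Finset.measurable_sum _ fun i _ => ?_).const_mul _).neg
  have h : Measurable fun p : (Fin m → (Fin M → ℝ) × ℝ) × (Fin M → ℝ) => (p.1 i, p.2) := by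
    fun_prop
  exact (measurable_uncurry_resid.comp h).pow_const 2

lemma measurable_neg_logWeight (β : ℝ) (D : Fin m → (Fin M → ℝ) × ℝ) :
    Measurable fun lam => 1 / β * ∑ i, resid lam (D i) ^ 2 := by
  refine (Finset.measurable_sum _ fun i _ => ?_).const_mul _
  have h : Measurable fun lam : Fin M → ℝ => (D i, lam) := by fun_prop
  exact (measurable_uncurry_resid.comp h).pow_const 2

lemma logWeight_cons (β : ℝ) (z : (Fin M → ℝ) × ℝ) (D : Fin m → (Fin M → ℝ) × ℝ)
    (lam : Fin M → ℝ) : logWeight β (Fin.cons z D : Fin (m + 1) → (Fin M → ℝ) × ℝ) lam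
      = logWeight β D lam + -(1 / β * resid lam z ^ 2) := by
  simp only [logWeight, Fin.sum_univ_succ, Fin.cons_zero, Fin.cons_succ]
  ring

lemma neg_logWeight_nonneg {β : ℝ} (hβ : 0 < β) (D : Fin m → (Fin M → ℝ) × ℝ)
    (lam : Fin M → ℝ) : 0 ≤ 1 / β * ∑ i, resid lam (D i) ^ 2 := by positivity

lemma neg_logWeight_le {β R : ℝ} (hβ : 0 < β) {D : Fin m → (Fin M → ℝ) × ℝ}
    (hD : ∀ i j, |(D i).1 j| ≤ 1) (lamStar : Fin M → ℝ) {lam : Fin M → ℝ}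
    (hlam : l1norm lam ≤ R) : 1 / β * ∑ i, resid lam (D i) ^ 2
      ≤ 1 / β * ∑ i, (2 * resid lamStar (D i) ^ 2 + 2 * (R + l1norm lamStar) ^ 2) :=
  mul_le_mul_of_nonneg_left (Finset.sum_le_sum fun i _ => resid_sq_le (hD i) hlam) (by positivity)

variable {π : Measure (Fin M → ℝ)}

lemma posteriorMean_apply (β : ℝ) (D : Fin m → (Fin M → ℝ) × ℝ) (j : Fin M) :
    posteriorMean π β D j
      = ∫ lam, lam j * (Real.exp (logWeight β D lam) / evidence π β D) ∂π := by
  rw [posteriorMean, integral_tilted]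
  refine integral_congr_ae (Filter.Eventually.of_forall fun lam => ?_)
  simp only [smul_eq_mul]
  rw [mul_comm]
  rfl

/-- Updating the posterior by one observation multiplies the weights, so the mixture likelihood of
the new point is a ratio of evidences; this is the source of the telescoping. -/
lemma integral_exp_posterior (β : ℝ) (D : Fin m → (Fin M → ℝ) × ℝ) (z : (Fin M → ℝ) × ℝ) :
    ∫ lam, Real.exp (-(1 / β * resid lam z ^ 2)) ∂(π.tilted (logWeight β D))
      = evidence π β (Fin.cons z D : Fin (m + 1) → (Fin M → ℝ) × ℝ) / evidence π β D := by
  rw [integral_exp_tilted]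
  unfold evidence
  simp_rw [logWeight_cons]
  rfl

lemma predRisk_nonneg {ν : Measure ((Fin M → ℝ) × ℝ)} (v : Fin M → ℝ) : 0 ≤ predRisk ν v :=
  integral_nonneg fun _ => sq_nonneg _

variable [IsProbabilityMeasure π]

lemma integrable_exp_logWeight {β : ℝ} (hβ : 0 < β) (D : Fin m → (Fin M → ℝ) × ℝ) :
    Integrable (fun lam => Real.exp (logWeight β D lam)) π :=
  integrable_exp_neg_of_nonneg
    (measurable_neg_logWeight β D) (neg_logWeight_nonneg hβ D)

lemma evidence_pos {β : ℝ} (hβ : 0 < β) (D : Fin m → (Fin M → ℝ) × ℝ) : 0 < evidence π β D :=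
  integral_exp_pos (integrable_exp_logWeight hβ D)

lemma measurable_evidence (β : ℝ) :
    Measurable fun D : Fin m → (Fin M → ℝ) × ℝ => evidence π β D :=
  (StronglyMeasurable.integral_prod_right
    (f := fun (D : Fin m → (Fin M → ℝ) × ℝ) lam => Real.exp (logWeight β D lam))
    (measurable_uncurry_logWeight β).exp.stronglyMeasurable).measurable

lemma measurable_posteriorMean (β : ℝ) :
    Measurable fun D : Fin m → (Fin M → ℝ) × ℝ => posteriorMean π β D := by
  refine measurable_pi_lambda _ fun j => ?_
  simp_rw [posteriorMean_apply]
  refine (StronglyMeasurable.integral_prod_right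
    (f := fun (D : Fin m → (Fin M → ℝ) × ℝ) (lam : Fin M → ℝ) =>
      lam j * (Real.exp (logWeight β D lam) / evidence π β D)) ?_).measurable
  exact (((measurable_pi_apply j).comp measurable_snd).mul
    ((measurable_uncurry_logWeight β).exp.div
      ((measurable_evidence β).comp measurable_fst))).stronglyMeasurable

lemma isProbabilityMeasure_posterior {β : ℝ} (hβ : 0 < β) (D : Fin m → (Fin M → ℝ) × ℝ) :
    IsProbabilityMeasure (π.tilted (logWeight β D)) :=
  isProbabilityMeasure_tilted (integrable_exp_logWeight hβ D)

lemma l1norm_posteriorMean_le {R β : ℝ} (hπ : ∀ᵐ lam ∂π, l1norm lam ≤ R) (hβ : 0 < β)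
    (D : Fin m → (Fin M → ℝ) × ℝ) : l1norm (posteriorMean π β D) ≤ R :=
  have := isProbabilityMeasure_posterior (π := π) hβ D
  l1norm_integral_le ((tilted_absolutelyContinuous π _).ae_le hπ)

variable {ν : Measure ((Fin M → ℝ) × ℝ)} [IsProbabilityMeasure ν] {lamStar : Fin M → ℝ} {σ : ℝ}

/-- Fubini with the new observation placed at index `0`, matching `Fin.cons` in `logWeight_cons`;
under a product of identical laws the position is immaterial. -/
lemma integral_pi_succ {f : (Fin (m + 1) → (Fin M → ℝ) × ℝ) → ℝ}
    (hf : Integrable f (Measure.pi fun _ => ν)) :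
    ∫ D, f D ∂(Measure.pi fun _ : Fin (m + 1) => ν)
      = ∫ D, ∫ z, f (Fin.cons z D) ∂ν ∂(Measure.pi fun _ : Fin m => ν) ∧
    Integrable (fun D => ∫ z, f (Fin.cons z D) ∂ν) (Measure.pi fun _ : Fin m => ν) := by
  have hmp := (measurePreserving_piFinSuccAbove (fun _ : Fin (m + 1) => ν) 0).symm
  have hcons : ∀ p : ((Fin M → ℝ) × ℝ) × (Fin m → (Fin M → ℝ) × ℝ),
      (MeasurableEquiv.piFinSuccAbove (fun _ : Fin (m + 1) => (Fin M → ℝ) × ℝ) 0).symm p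
        = Fin.cons p.1 p.2 := fun p => Fin.insertNth_zero' p.1 p.2
  have hint : Integrable (fun p : ((Fin M → ℝ) × ℝ) × (Fin m → (Fin M → ℝ) × ℝ) =>
      f (Fin.cons p.1 p.2)) (ν.prod (Measure.pi fun _ : Fin m => ν)) := by
    have := (hmp.integrable_comp_emb (MeasurableEquiv.measurableEmbedding _)).2 hf
    refine this.congr (Filter.Eventually.of_forall fun p => ?_)
    simp only [Function.comp, hcons]
  have : SigmaFinite (Measure.pi fun _ : Fin m => ν) := Measure.pi.sigmaFinite _
  refine ⟨?_, hint.integral_prod_right⟩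
  rw [← hmp.integral_comp']
  refine Eq.trans ?_ (integral_prod_symm _ hint)
  exact integral_congr_ae (Filter.Eventually.of_forall fun p => congrArg f (hcons p))

lemma ae_pi_of_ae {p : (Fin M → ℝ) × ℝ → Prop} (hp : ∀ᵐ z ∂ν, p z) :
    ∀ᵐ D ∂(Measure.pi fun _ : Fin m => ν), ∀ i, p (D i) :=
  ae_all_iff.2 fun i => (measurePreserving_eval (fun _ : Fin m => ν) i).quasiMeasurePreserving.ae hp

lemma IsSubGaussianModel.integrable_log_evidence (hν : IsSubGaussianModel ν lamStar σ) {R β : ℝ}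
    (hπ : ∀ᵐ lam ∂π, l1norm lam ≤ R) (hβ : 0 < β) :
    Integrable (fun D => Real.log (evidence π β D)) (Measure.pi fun _ : Fin m => ν) := by
  have hb : Integrable (fun D => 1 / β * ∑ i, (2 * resid lamStar (D i) ^ 2
      + 2 * (R + l1norm lamStar) ^ 2)) (Measure.pi fun _ : Fin m => ν) := by
    refine (integrable_finsetSum _ fun i _ => ?_).const_mul _
    exact ((integrable_comp_eval (μ := fun _ : Fin m => ν) (i := i) hν.integrable_sq).const_mul
      2).add (integrable_const _)
  refine hb.mono' (measurable_evidence β).log.aestronglyMeasurable ?_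
  filter_upwards [ae_pi_of_ae hν.abs_le_one] with D hD
  exact abs_log_integral_exp_neg_le (measurable_neg_logWeight β D)
    (neg_logWeight_nonneg hβ D) (hπ.mono fun lam hlam => neg_logWeight_le hβ hD lamStar hlam)

lemma measurable_predRisk (hν : ∀ᵐ z ∂ν, ∀ j, |z.1 j| ≤ 1) : Measurable (predRisk ν) := by
  have : predRisk ν = fun v => ∑ j, ∑ k, v j * v k * ∫ z, z.1 j * z.1 k ∂ν :=
    funext fun v => predRisk_eq_sum hν v
  rw [this]
  fun_prop

lemma IsSubGaussianModel.predRisk_sub_le (hν : IsSubGaussianModel ν lamStar σ) {R : ℝ}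
    {v : Fin M → ℝ} (hv : l1norm v ≤ R) : predRisk ν (v - lamStar) ≤ (R + l1norm lamStar) ^ 2 :=
  (hν.predRisk_le _).trans (pow_le_pow_left₀ (l1norm_nonneg _)
    ((l1norm_sub_le _ _).trans (by linarith)) 2)

lemma IsSubGaussianModel.integrable_predRisk (hν : IsSubGaussianModel ν lamStar σ) {Λ : Type*}
    [MeasurableSpace Λ] {P : Measure Λ} [IsFiniteMeasure P] {f : Λ → Fin M → ℝ}
    (hf : Measurable f) {R : ℝ} (hR : ∀ᵐ l ∂P, l1norm (f l) ≤ R) :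
    Integrable (fun l => predRisk ν (f l - lamStar)) P := by
  refine Integrable.of_bound
    ((measurable_predRisk hν.abs_le_one).comp (hf.sub measurable_const)).aestronglyMeasurable
    ((R + l1norm lamStar) ^ 2) ?_
  filter_upwards [hR] with l hl
  rw [Real.norm_of_nonneg (predRisk_nonneg _)]
  exact hν.predRisk_sub_le hl

lemma IsSubGaussianModel.integral_predRisk_posteriorMean_le (hν : IsSubGaussianModel ν lamStar σ)
    {R β : ℝ} (hπ : ∀ᵐ lam ∂π, l1norm lam ≤ R) (hβ0 : 0 < β)
    (hβ : 2 * σ ^ 2 + 2 * (R + l1norm lamStar) ^ 2 ≤ β) :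
    ∫ z, resid lamStar z ^ 2 ∂ν
        + ∫ D, predRisk ν (posteriorMean π β D - lamStar) ∂(Measure.pi fun _ : Fin m => ν)
      ≤ β * ∫ D, Real.log (evidence π β D) ∂(Measure.pi fun _ : Fin m => ν)
        - β * ∫ D, Real.log (evidence π β D) ∂(Measure.pi fun _ : Fin (m + 1) => ν) := by
  obtain ⟨hsucc, hsuccint⟩ := integral_pi_succ (m := m) (hν.integrable_log_evidence hπ hβ0)
  have hlog := hν.integrable_log_evidence (m := m) hπ hβ0
  have hrisk : Integrable (fun D => predRisk ν (posteriorMean π β D - lamStar))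
      (Measure.pi fun _ : Fin m => ν) :=
    hν.integrable_predRisk (measurable_posteriorMean β)
      (Filter.Eventually.of_forall fun D => l1norm_posteriorMean_le hπ hβ0 D)
  have hstep : ∀ D : Fin m → (Fin M → ℝ) × ℝ,
      ∫ z, resid lamStar z ^ 2 ∂ν + predRisk ν (posteriorMean π β D - lamStar)
        ≤ β * Real.log (evidence π β D) - β * ∫ z, Real.log
            (evidence π β (Fin.cons z D : Fin (m + 1) → (Fin M → ℝ) × ℝ)) ∂ν := fun D => by
    have := isProbabilityMeasure_posterior (π := π) hβ0 D
    have hP := (tilted_absolutelyContinuous π (logWeight β D)).ae_le hπ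
    have h1 := hν.predRisk_mean_le hP hβ0 hβ
    have h2 := hν.integrable_log_integral_exp_resid hP hβ0
    have e : ∀ z, Real.log (∫ lam, Real.exp (-(1 / β * resid lam z ^ 2))
          ∂(π.tilted (logWeight β D)))
        = Real.log (evidence π β (Fin.cons z D : Fin (m + 1) → (Fin M → ℝ) × ℝ))
          - Real.log (evidence π β D) := fun z => by
      rw [integral_exp_posterior, Real.log_div (evidence_pos hβ0 _).ne' (evidence_pos hβ0 _).ne']
    simp_rw [e] at h1 h2
    have h3 : Integrable (fun z => Real.log
        (evidence π β (Fin.cons z D : Fin (m + 1) → (Fin M → ℝ) × ℝ))) ν := by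
      refine (h2.add (integrable_const (Real.log (evidence π β D)))).congr
        (Filter.Eventually.of_forall fun z => ?_)
      simp only [Pi.add_apply, sub_add_cancel]
    rw [integral_sub h3 (integrable_const _)] at h1
    simp only [integral_const, probReal_univ, one_smul] at h1
    unfold posteriorMean
    linarith
  have h := integral_mono ((integrable_const _).add hrisk)
    ((hlog.const_mul β).sub (hsuccint.const_mul β)) hstep
  have e1 := integral_add (integrable_const (∫ z, resid lamStar z ^ 2 ∂ν)) hrisk
  have e2 := integral_sub (hlog.const_mul β) (hsuccint.const_mul β)
  simp only [integral_const, probReal_univ, one_smul] at e1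
  rw [integral_const_mul, integral_const_mul, ← hsucc] at e2
  simp only [Pi.add_apply, Pi.sub_apply] at h
  linarith

/-- The one-step inequalities telescope, starting from the evidence of the empty sample, which is
`1`. -/
lemma IsSubGaussianModel.sum_integral_predRisk_le (hν : IsSubGaussianModel ν lamStar σ)
    {R β : ℝ} (hπ : ∀ᵐ lam ∂π, l1norm lam ≤ R) (hβ0 : 0 < β)
    (hβ : 2 * σ ^ 2 + 2 * (R + l1norm lamStar) ^ 2 ≤ β) (k : ℕ) :
    k * ∫ z, resid lamStar z ^ 2 ∂ν + ∑ m ∈ Finset.range k,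
        ∫ D, predRisk ν (posteriorMean π β D - lamStar) ∂(Measure.pi fun _ : Fin m => ν)
      ≤ -(β * ∫ D, Real.log (evidence π β D) ∂(Measure.pi fun _ : Fin k => ν)) := by
  induction k with
  | zero => simp [evidence, logWeight]
  | succ k ih =>
    rw [Finset.sum_range_succ]
    have := hν.integral_predRisk_posteriorMean_le (m := k) hπ hβ0 hβ
    push_cast
    linarith

/-! ### Variational upper bound for the negative log-evidence -/

lemma IsSubGaussianModel.integrable_uncurry_resid_sq (hν : IsSubGaussianModel ν lamStar σ)
    {p : Measure (Fin M → ℝ)} [IsProbabilityMeasure p] {R : ℝ}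
    (hp : ∀ᵐ lam ∂p, l1norm lam ≤ R) :
    Integrable (fun q : ((Fin M → ℝ) × ℝ) × (Fin M → ℝ) => resid q.2 q.1 ^ 2) (ν.prod p) := by
  have hfst : Integrable (fun q : ((Fin M → ℝ) × ℝ) × (Fin M → ℝ) =>
      2 * resid lamStar q.1 ^ 2 + 2 * (R + l1norm lamStar) ^ 2) (ν.prod p) :=
    ((hν.integrable_sq.comp_fst p).const_mul 2).add (integrable_const _)
  refine hfst.mono' (measurable_uncurry_resid.pow_const 2).aestronglyMeasurable ?_
  filter_upwards [Measure.quasiMeasurePreserving_fst.ae hν.abs_le_one,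
    Measure.quasiMeasurePreserving_snd.ae hp] with q h1 h2
  rw [Real.norm_of_nonneg (sq_nonneg _)]
  exact resid_sq_le h1 h2

/-- The variational bound on the evidence by a distribution dominated by the prior. -/
lemma IsSubGaussianModel.neg_integral_log_evidence_le (hν : IsSubGaussianModel ν lamStar σ)
    {R β K : ℝ} (hπ : ∀ᵐ lam ∂π, l1norm lam ≤ R) (hβ : 0 < β) (hK : 0 < K)
    {p : Measure (Fin M → ℝ)} [IsProbabilityMeasure p] (hp : p ≤ ENNReal.ofReal K • π) (k : ℕ) :
    -(β * ∫ D, Real.log (evidence π β D) ∂(Measure.pi fun _ : Fin k => ν))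
      ≤ β * Real.log K
        + k * (∫ z, resid lamStar z ^ 2 ∂ν + ∫ lam, predRisk ν (lam - lamStar) ∂p) := by
  have hpR : ∀ᵐ lam ∂p, l1norm lam ≤ R :=
    (Measure.absolutelyContinuous_of_le hp).ae_le (Measure.ae_smul_measure hπ _)
  have hprod := hν.integrable_uncurry_resid_sq hpR
  have hmarg : Integrable (fun z => ∫ lam, resid lam z ^ 2 ∂p) ν := hprod.integral_prod_left
  have hpt : ∀ᵐ D ∂(Measure.pi fun _ : Fin k => ν), -(β * Real.log (evidence π β D))
      ≤ β * Real.log K + ∑ i, ∫ lam, resid lam (D i) ^ 2 ∂p := by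
    filter_upwards [ae_pi_of_ae hν.abs_le_one] with D hD
    have hri : ∀ i, Integrable (fun lam => resid lam (D i) ^ 2) p := fun i => by
      refine Integrable.of_bound ((measurable_uncurry_resid.comp (measurable_const.prodMk
        measurable_id)).pow_const 2).aestronglyMeasurable
        (2 * resid lamStar (D i) ^ 2 + 2 * (R + l1norm lamStar) ^ 2) ?_
      filter_upwards [hpR] with lam hlam
      rw [Real.norm_of_nonneg (sq_nonneg _)]
      exact resid_sq_le (hD i) hlam
    have hlw : Integrable (logWeight β D) p :=
      ((integrable_finsetSum _ fun i _ => hri i).const_mul _).neg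
    have hlwint : ∫ lam, logWeight β D lam ∂p
        = -(1 / β * ∑ i, ∫ lam, resid lam (D i) ^ 2 ∂p) := by
      unfold logWeight
      rw [integral_neg, integral_const_mul, integral_finsetSum _ fun i _ => hri i]
    have hJ : Real.exp (∫ lam, logWeight β D lam ∂p) ≤ ∫ lam, Real.exp (logWeight β D lam) ∂p :=
      convexOn_exp.map_integral_le Real.continuous_exp.continuousOn isClosed_univ
        (Filter.Eventually.of_forall fun _ => Set.mem_univ _) hlw (integrable_exp_logWeight hβ D)
    -- Domination of `p` by `K π` lets `log K` play the role of a relative entropy, with no density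
    -- of `p` needed.
    have hdom : ∫ lam, Real.exp (logWeight β D lam) ∂p ≤ K * evidence π β D := by
      have := integral_mono_measure hp
        (Filter.Eventually.of_forall fun lam => (Real.exp_pos (logWeight β D lam)).le)
        ((integrable_exp_logWeight hβ D).smul_measure ENNReal.ofReal_ne_top)
      rwa [integral_smul_measure, ENNReal.toReal_ofReal hK.le, smul_eq_mul] at this
    have hlog := Real.log_le_log (Real.exp_pos _) (hJ.trans hdom)
    rw [Real.log_exp, Real.log_mul hK.ne' (evidence_pos hβ D).ne', hlwint] at hlog
    have := mul_le_mul_of_nonneg_left hlog hβ.le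
    rw [mul_neg, ← mul_assoc, mul_one_div_cancel hβ.ne', one_mul, mul_add] at this
    linarith
  have hcomp : ∀ i : Fin k, Integrable (fun D : Fin k → (Fin M → ℝ) × ℝ =>
      ∫ lam, resid lam (D i) ^ 2 ∂p) (Measure.pi fun _ : Fin k => ν) := fun i =>
    integrable_comp_eval (μ := fun _ : Fin k => ν) (i := i) hmarg
  have hval : ∫ z, ∫ lam, resid lam z ^ 2 ∂p ∂ν
      = ∫ z, resid lamStar z ^ 2 ∂ν + ∫ lam, predRisk ν (lam - lamStar) ∂p := by
    rw [integral_integral_swap hprod]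
    have hi : Integrable (fun lam => predRisk ν (lam - lamStar)) p :=
      hν.integrable_predRisk measurable_id hpR
    rw [integral_congr_ae (Filter.Eventually.of_forall hν.integral_resid_sq),
      integral_add (integrable_const _) hi]
    simp
  have hlogint := hν.integrable_log_evidence (m := k) hπ hβ
  have hsum : Integrable (fun D : Fin k → (Fin M → ℝ) × ℝ =>
      ∑ i, ∫ lam, resid lam (D i) ^ 2 ∂p) (Measure.pi fun _ : Fin k => ν) :=
    integrable_finsetSum _ fun i _ => hcomp i
  have h := integral_mono_ae (hlogint.const_mul β).neg ((integrable_const _).add hsum) hpt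
  have e1 := integral_neg (μ := Measure.pi fun _ : Fin k => ν)
    fun D => β * Real.log (evidence π β D)
  have e2 := integral_add (integrable_const (β * Real.log K)) hsum
  have e3 : ∀ i : Fin k, ∫ D, ∫ lam, resid lam (D i) ^ 2 ∂p ∂(Measure.pi fun _ : Fin k => ν)
      = ∫ z, ∫ lam, resid lam z ^ 2 ∂p ∂ν := fun i =>
    integral_comp_eval (μ := fun _ : Fin k => ν) (i := i)
      (f := fun z => ∫ lam, resid lam z ^ 2 ∂p) hmarg.aestronglyMeasurable
  rw [integral_finsetSum _ fun i _ => hcomp i] at e2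
  simp_rw [e3] at e2
  simp only [integral_const, probReal_univ, one_smul, Finset.sum_const, Finset.card_univ,
    Fintype.card_fin, nsmul_eq_mul, hval] at e2
  rw [integral_const_mul] at e1
  simp only [Pi.neg_apply, Pi.add_apply] at h
  linarith

end

/-! ### Transfer to the underlying probability space -/

section

variable {Ω : Type*} [MeasurableSpace Ω] {μ : Measure Ω} {M n : ℕ}

lemma secondMoment_eq_map {X : Ω → Fin M → ℝ} {Y : Ω → ℝ} (hX : Measurable X)
    (hY : Measurable Y) (j k : Fin M) :
    secondMoment μ X j k = ∫ z, z.1 j * z.1 k ∂(μ.map fun ω => (X ω, Y ω)) := by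
  rw [integral_map (hX.prodMk hY).aemeasurable (Measurable.aestronglyMeasurable (by fun_prop))]
  rfl

variable [IsProbabilityMeasure μ]

/-- Conditional sub-Gaussianity for deterministic exponents implies the integrated bound for
exponents that depend on the conditioning variable. -/
lemma lintegral_exp_add_mul_le {X : Ω → Fin M → ℝ} {ξ : Ω → ℝ} (hX : Measurable X)
    (hξ : Measurable ξ) {σ : ℝ} (hint : ∀ t : ℝ, Integrable (fun ω => Real.exp (t * ξ ω)) μ)
    (hsubG : ∀ t : ℝ, ∀ᵐ ω ∂μ,
      (μ[fun ω' => Real.exp (t * ξ ω') | MeasurableSpace.comap X MeasurableSpace.pi]) ω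
        ≤ Real.exp (σ ^ 2 * t ^ 2 / 2))
    {g T : (Fin M → ℝ) → ℝ} (hg : Measurable g) (hT : Measurable T) :
    ∫⁻ ω, ENNReal.ofReal (Real.exp (g (X ω) + T (X ω) * ξ ω)) ∂μ
      ≤ ∫⁻ ω, ENNReal.ofReal (Real.exp (g (X ω) + σ ^ 2 * T (X ω) ^ 2 / 2)) ∂μ := by
  set κ := condDistrib ξ X μ with hκ
  have hsub : Kernel.HasSubgaussianMGF id (σ ^ 2).toNNReal κ (μ.map X) := by
    -- The exceptional null set depends on `t`. Countably many rational `t` suffice, after which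
    -- almost every conditional law satisfies the bound for all `t` at once and `t = T x` may be
    -- substituted.
    refine Kernel.HasSubgaussianMGF.of_rat (fun t => ?_) fun q => ?_
    · rw [hκ, condDistrib_comp_map hX.aemeasurable hξ.aemeasurable,
        integrable_map_measure (Measurable.aestronglyMeasurable (by fun_prop)) hξ.aemeasurable]
      exact hint t
    · have hm : Measurable fun x => mgf id (κ x) (q : ℝ) := by
        unfold mgf
        exact (StronglyMeasurable.integral_kernel (κ := κ)
          (f := fun y : ℝ => Real.exp ((q : ℝ) * id y))
          (Measurable.stronglyMeasurable (by fun_prop))).measurable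
      rw [ae_map_iff hX.aemeasurable (measurableSet_le hm measurable_const)]
      have hc := condExp_ae_eq_integral_condDistrib (μ := μ) hX hξ.aemeasurable
        (f := fun y : ℝ => Real.exp ((q : ℝ) * y))
        (Measurable.stronglyMeasurable (by fun_prop)) (hint q)
      filter_upwards [hc, hsubG q] with ω h1 h2
      rw [h1] at h2
      rw [Real.coe_toNNReal _ (sq_nonneg σ)]
      exact h2
  have hmeas : Measurable fun p : (Fin M → ℝ) × ℝ =>
      ENNReal.ofReal (Real.exp (g p.1 + T p.1 * p.2)) := by fun_prop
  have hpair : Measurable fun ω => (X ω, ξ ω) := hX.prodMk hξ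
  calc ∫⁻ ω, ENNReal.ofReal (Real.exp (g (X ω) + T (X ω) * ξ ω)) ∂μ
      = ∫⁻ x, ∫⁻ y, ENNReal.ofReal (Real.exp (g x + T x * y)) ∂(κ x) ∂(μ.map X) := by
        rw [← Measure.lintegral_compProd hmeas, hκ, compProd_map_condDistrib hξ.aemeasurable,
          lintegral_map hmeas hpair]
    _ ≤ ∫⁻ x, ENNReal.ofReal (Real.exp (g x + σ ^ 2 * T x ^ 2 / 2)) ∂(μ.map X) := by
        refine lintegral_mono_ae ?_
        filter_upwards [hsub.mgf_le, hsub.ae_forall_integrable_exp_mul] with x h1 h2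
        have h3 : Integrable (fun y : ℝ => Real.exp (g x + T x * y)) (κ x) := by
          simp_rw [Real.exp_add]
          exact (h2 (T x)).const_mul _
        rw [← ofReal_integral_eq_lintegral_ofReal h3
          (Filter.Eventually.of_forall fun y => (Real.exp_pos _).le)]
        refine ENNReal.ofReal_le_ofReal ?_
        simp_rw [Real.exp_add]
        rw [integral_const_mul]
        refine mul_le_mul_of_nonneg_left ?_ (Real.exp_pos _).le
        have := h1 (T x)
        rwa [Real.coe_toNNReal _ (sq_nonneg σ)] at this
    _ = ∫⁻ ω, ENNReal.ofReal (Real.exp (g (X ω) + σ ^ 2 * T (X ω) ^ 2 / 2)) ∂μ :=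
        lintegral_map (by fun_prop) hX

lemma isSubGaussianModel_map {X : Ω → Fin M → ℝ} {Y ξ : Ω → ℝ} (hX : Measurable X)
    (hY : Measurable Y) {lamStar : Fin M → ℝ} {σ : ℝ}
    (hmodel : ∀ ω, Y ω = X ω ⬝ᵥ lamStar + ξ ω)
    (hsupp : ∀ᵐ ω ∂μ, ∀ j, X ω j ∈ Set.Icc (-1 : ℝ) 1)
    (hint : ∀ t : ℝ, Integrable (fun ω => Real.exp (t * ξ ω)) μ)
    (hsubG : ∀ t : ℝ, ∀ᵐ ω ∂μ,
      (μ[fun ω' => Real.exp (t * ξ ω') | MeasurableSpace.comap X MeasurableSpace.pi]) ω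
        ≤ Real.exp (σ ^ 2 * t ^ 2 / 2)) :
    IsSubGaussianModel (μ.map fun ω => (X ω, Y ω)) lamStar σ := by
  have hZ : Measurable fun ω => (X ω, Y ω) := hX.prodMk hY
  have hr : ∀ ω, resid lamStar (X ω, Y ω) = ξ ω := fun ω => by
    simp [resid, hmodel ω]
  have hξ : Measurable ξ := by
    have : ξ = fun ω => resid lamStar (X ω, Y ω) := funext fun ω => (hr ω).symm
    rw [this]
    exact (measurable_resid lamStar).comp hZ
  have hrm := measurable_resid lamStar
  refine ⟨?_, fun t => ?_, fun g T hg hT => ?_⟩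
  · rw [ae_map_iff hZ.aemeasurable (measurableSet_setOfPred.2 (by measurability))]
    exact hsupp.mono fun ω h j => abs_le.2 (Set.mem_Icc.1 (h j))
  · rw [integrable_map_measure (Measurable.aestronglyMeasurable (by fun_prop)) hZ.aemeasurable]
    simpa only [Function.comp_def, hr] using hint t
  · rw [lintegral_map (by fun_prop) hZ, lintegral_map (by fun_prop) hZ]
    simpa only [hr] using lintegral_exp_add_mul_le hX hξ hint hsubG hg hT

lemma expWeight_eq {β : ℝ} {x : Fin n → Fin M → ℝ} {y : Fin n → ℝ} {m : ℕ} (hm : m ≤ n)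
    (lam : Fin M → ℝ) : expWeight β x y m lam
      = Real.exp (logWeight β (fun i : Fin m => (x (Fin.castLE hm i), y (Fin.castLE hm i))) lam) := by
  have : Finset.univ.filter (fun i : Fin n => (i : ℕ) < m)
      = Finset.univ.map (Fin.castLEEmb hm) := by
    ext i
    simp only [Finset.mem_filter, Finset.mem_univ, true_and, Finset.mem_map]
    exact ⟨fun h => ⟨⟨i, h⟩, rfl⟩, fun ⟨a, h⟩ => h ▸ a.2⟩
  rw [expWeight, this, Finset.sum_map, neg_mul]
  rfl

lemma mirrorAveraging_eq {τ R β : ℝ} (x : Fin n → Fin M → ℝ) (y : Fin n → ℝ) :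
    mirrorAveraging τ R β x y = (1 / ((n : ℝ) + 1)) • ∑ m : Fin (n + 1),
      posteriorMean (sparsityPrior M τ R) β (fun i : Fin m =>
        (x (Fin.castLE (Nat.le_of_lt_succ m.2) i), y (Fin.castLE (Nat.le_of_lt_succ m.2) i))) := by
  funext j
  rw [mirrorAveraging, Pi.smul_apply, smul_eq_mul, Finset.sum_apply, Finset.sum_range]
  congr 1
  refine Finset.sum_congr rfl fun m _ => ?_
  rw [posteriorMean_apply]
  simp_rw [posteriorDensity, expWeight_eq (Nat.le_of_lt_succ m.2)]
  rfl

/-- Moves the expectations of the risks from `Ω` to the product spaces on which the telescoping is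
carried out. -/
lemma map_castLE_eq_pi {E : Type*} [MeasurableSpace E] {Z : Fin n → Ω → E}
    (hZ : ∀ i, Measurable (Z i)) (hindep : iIndepFun Z μ) {ν : Measure E}
    (hν : ∀ i, μ.map (Z i) = ν) {m : ℕ} (hm : m ≤ n) :
    μ.map (fun ω (i : Fin m) => Z (Fin.castLE hm i) ω) = Measure.pi fun _ => ν := by
  have h := hindep.precomp (Fin.castLE_injective hm)
  rw [iIndepFun_iff_map_fun_eq_pi_map fun i => (hZ _).aemeasurable] at h
  simpa only [hν] using h

lemma sqrtNormSq_eq {A : Matrix (Fin M) (Fin M) ℝ} (hA : A.PosSemidef) (v : Fin M → ℝ) :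
    sqrtNormSq A v = v ⬝ᵥ (A *ᵥ v) := by
  have hs : (CFC.sqrt A)ᵀ = CFC.sqrt A := by
    have := (Matrix.nonneg_iff_posSemidef.1 (CFC.sqrt_nonneg A)).isHermitian
    rwa [Matrix.IsHermitian, Matrix.conjTranspose_eq_transpose_of_trivial] at this
  have h2 := CFC.sqrt_mul_sqrt_self A (Matrix.nonneg_iff_posSemidef.2 hA)
  rw [sqrtNormSq, EuclideanSpace.real_norm_sq_eq]
  calc ∑ i, (CFC.sqrt A *ᵥ v) i ^ 2 = (CFC.sqrt A *ᵥ v) ⬝ᵥ (CFC.sqrt A *ᵥ v) := by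
        simp only [dotProduct, sq]
    _ = v ⬝ᵥ (A *ᵥ v) := by
        rw [Matrix.dotProduct_mulVec, ← Matrix.vecMul_transpose, hs, Matrix.vecMul_vecMul, h2,
          ← Matrix.dotProduct_mulVec]

lemma sqrtNormSq_secondMoment {X : Ω → Fin M → ℝ} {Y : Ω → ℝ} (hX : Measurable X)
    (hY : Measurable Y) (hsupp : ∀ᵐ z ∂(μ.map fun ω => (X ω, Y ω)), ∀ j, |z.1 j| ≤ 1)
    (v : Fin M → ℝ) :
    sqrtNormSq (secondMoment μ X) v = predRisk (μ.map fun ω => (X ω, Y ω)) v := by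
  have := Measure.isProbabilityMeasure_map (μ := μ) (hX.prodMk hY).aemeasurable
  have hquad : ∀ v : Fin M → ℝ, v ⬝ᵥ (secondMoment μ X *ᵥ v)
      = predRisk (μ.map fun ω => (X ω, Y ω)) v := fun v => by
    rw [predRisk_eq_sum hsupp]
    simp only [dotProduct, Matrix.mulVec, Finset.mul_sum, secondMoment_eq_map hX hY]
    exact Finset.sum_congr rfl fun j _ => Finset.sum_congr rfl fun k _ => by ring
  rw [sqrtNormSq_eq, hquad]
  refine Matrix.PosSemidef.of_dotProduct_mulVec_nonneg ?_ fun v => ?_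
  · ext j k
    simp [secondMoment, mul_comm]
  · rw [star_trivial, hquad]
    exact predRisk_nonneg v

lemma predRisk_average_le {ν : Measure ((Fin M → ℝ) × ℝ)} [IsProbabilityMeasure ν]
    {lamStar : Fin M → ℝ} {σ : ℝ} (hν : IsSubGaussianModel ν lamStar σ)
    (v : Fin (n + 1) → Fin M → ℝ) :
    predRisk ν ((1 / ((n : ℝ) + 1)) • (∑ m, v m) - lamStar)
      ≤ 1 / ((n : ℝ) + 1) * ∑ m, predRisk ν (v m - lamStar) := by
  have hn : (0 : ℝ) < (n : ℝ) + 1 := by positivity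
  unfold predRisk
  rw [← integral_finsetSum _ fun m _ => hν.integrable_dotProduct_sq _, ← integral_const_mul]
  refine integral_mono (hν.integrable_dotProduct_sq _)
    ((integrable_finsetSum _ fun m _ => hν.integrable_dotProduct_sq _).const_mul _) fun z => ?_
  have e : (1 / ((n : ℝ) + 1)) • (∑ m, v m) - lamStar
      = (1 / ((n : ℝ) + 1)) • ∑ m, (v m - lamStar) := by
    rw [Finset.sum_sub_distrib, smul_sub, Finset.sum_const, Finset.card_univ, Fintype.card_fin,
      ← Nat.cast_smul_eq_nsmul ℝ, smul_smul]
    push_cast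
    rw [one_div_mul_cancel hn.ne', one_smul]
  -- Cauchy–Schwarz for `n + 1` terms, which is convexity of the square.
  have h := sq_sum_le_card_mul_sum_sq (s := Finset.univ) (f := fun m => z.1 ⬝ᵥ (v m - lamStar))
  rw [Finset.card_univ, Fintype.card_fin] at h
  push_cast at h
  simp only
  rw [e, dotProduct_smul, dotProduct_sum, smul_eq_mul, mul_pow]
  calc (1 / ((n : ℝ) + 1)) ^ 2 * (∑ m, z.1 ⬝ᵥ (v m - lamStar)) ^ 2
      ≤ (1 / ((n : ℝ) + 1)) ^ 2 * (((n : ℝ) + 1) * ∑ m, (z.1 ⬝ᵥ (v m - lamStar)) ^ 2) := by gcongr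
    _ = _ := by field_simp

/-- The prediction risk of the sparsity prior centered at the true parameter. -/
lemma integral_predRisk_sparsityPrior_le (hM : 0 < M) {ν : Measure ((Fin M → ℝ) × ℝ)}
    [IsProbabilityMeasure ν] (hν : ∀ᵐ z ∂ν, ∀ j, |z.1 j| ≤ 1) {τ : ℝ} (hτ : 0 < τ) :
    ∫ w, predRisk ν w ∂(sparsityPrior M τ (2 * M * τ))
      ≤ 4 * τ ^ 2 * ∑ j, ∫ z, z.1 j * z.1 j ∂ν := by
  have := isProbabilityMeasure_sparsityPrior hM hτ (le_refl (2 * M * τ))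
  have hR := ae_sparsityPrior (M := M) hτ (2 * M * τ)
  have hint : ∀ j k, Integrable (fun w : Fin M → ℝ => w j * w k * ∫ z, z.1 j * z.1 k ∂ν)
      (sparsityPrior M τ (2 * M * τ)) := fun j k => by
    refine Integrable.mul_const (Integrable.of_bound (C := (2 * M * τ) * (2 * M * τ))
      (Measurable.aestronglyMeasurable (by fun_prop)) ?_) _
    filter_upwards [hR] with w hw
    rw [Real.norm_eq_abs, abs_mul]
    exact mul_le_mul ((abs_apply_le_l1norm w j).trans hw) ((abs_apply_le_l1norm w k).trans hw)
      (abs_nonneg _) (by positivity)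
  simp_rw [predRisk_eq_sum hν]
  rw [integral_finsetSum _ fun j _ => integrable_finsetSum _ fun k _ => hint j k, Finset.mul_sum]
  refine Finset.sum_le_sum fun j _ => ?_
  rw [integral_finsetSum _ fun k _ => hint j k, Finset.sum_eq_single j]
  · rw [integral_mul_const]
    simp_rw [← sq]
    exact mul_le_mul_of_nonneg_right (integral_sq_sparsityPrior_le hM hτ j)
      (integral_nonneg fun z => sq_nonneg _)
  · intro k _ hkj
    rw [integral_mul_const, integral_mul_sparsityPrior_eq_zero hτ _ hkj.symm, zero_mul]
  · simp

/-- The leading `1` majorizes `log 2`, and the exponent of the translation factors becomes the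
coefficient `4`. -/
lemma log_two_mul_prod_le {τ : ℝ} (hτ : 0 < τ) (a : Fin M → ℝ) :
    Real.log (2 * ∏ j, (1 + |a j| / τ) ^ 4) ≤ 1 + 4 * ∑ j, Real.log (1 + |a j| / τ) := by
  have hpos : ∀ j, 0 < 1 + |a j| / τ := fun j => by positivity
  rw [Real.log_mul two_ne_zero (Finset.prod_pos fun j _ => pow_pos (hpos j) 4).ne',
    Real.log_prod fun j _ => (pow_pos (hpos j) 4).ne', Finset.mul_sum]
  simp_rw [Real.log_pow]
  have := Real.log_two_lt_d9
  push_cast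
  linarith

end

/-! ### The risk bound for mirror averaging -/

theorem proposition2 {Ω : Type*} [MeasurableSpace Ω] (μ : Measure Ω) [IsProbabilityMeasure μ]
    (M n : ℕ) [NeZero n] (hM : 2 ≤ M)
    (τ R σ β : ℝ) (hτ : 0 < τ) (hR : 0 < R)
    (lamStar : Fin M → ℝ)
    (X : Fin n → Ω → Fin M → ℝ) (Y ξ : Fin n → Ω → ℝ)
    (hXmeas : ∀ i, Measurable (X i)) (hYmeas : ∀ i, Measurable (Y i))
    -- the pairs `(Xᵢ, Yᵢ)` are i.i.d. and follow the linear model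
    (hindep : iIndepFun (fun i ω => (X i ω, Y i ω)) μ)
    (hident : ∀ i, IdentDistrib (fun ω => (X i ω, Y i ω)) (fun ω => (X 0 ω, Y 0 ω)) μ μ)
    (hmodel : ∀ i ω, Y i ω = X i ω ⬝ᵥ lamStar + ξ i ω)
    -- the distribution of `X₁` is supported in `[-1, 1] ^ M`
    (hsupp : ∀ᵐ ω ∂μ, ∀ j, X 0 ω j ∈ Set.Icc (-1 : ℝ) 1)
    -- conditionally on `X₁`, the noise `ξ₁` is sub-Gaussian
    (hint : ∀ t : ℝ, Integrable (fun ω => Real.exp (t * ξ 0 ω)) μ)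
    (hsubG : ∀ t : ℝ,
      ∀ᵐ ω ∂μ, (μ[fun ω' => Real.exp (t * ξ 0 ω') | MeasurableSpace.comap (X 0) MeasurableSpace.pi]) ω
        ≤ Real.exp (σ ^ 2 * t ^ 2 / 2))
    (hβ : 2 * σ ^ 2 + 2 * (R + l1norm lamStar) ^ 2 ≤ β)
    (hlam : l1norm lamStar ≤ R - 2 * M * τ) :
    Integrable (fun ω => sqrtNormSq (secondMoment μ (X 0))
        (mirrorAveraging τ R β (fun i => X i ω) (fun i => Y i ω) - lamStar)) μ ∧
      ∫ ω, sqrtNormSq (secondMoment μ (X 0))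
          (mirrorAveraging τ R β (fun i => X i ω) (fun i => Y i ω) - lamStar) ∂μ
        ≤ β / (n + 1) * (1 + 4 * ∑ j, Real.log (1 + |lamStar j| / τ))
          + 4 * τ ^ 2 * (secondMoment μ (X 0)).trace := by
  have hM0 : 0 < M := by omega
  have hn : (0 : ℝ) < (n : ℝ) + 1 := by positivity
  have hβ0 : 0 < β := by
    have := l1norm_nonneg lamStar
    have : 0 < (R + l1norm lamStar) ^ 2 := by positivity
    nlinarith [sq_nonneg σ]
  have hZ : ∀ i, Measurable fun ω => (X i ω, Y i ω) := fun i => (hXmeas i).prodMk (hYmeas i)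
  set ν := μ.map fun ω => (X 0 ω, Y 0 ω) with hνdef
  have hνprob : IsProbabilityMeasure ν := Measure.isProbabilityMeasure_map (hZ 0).aemeasurable
  have hν : IsSubGaussianModel ν lamStar σ :=
    isSubGaussianModel_map (hXmeas 0) (hYmeas 0) (hmodel 0) hsupp hint hsubG
  set π := sparsityPrior M τ R with hπdef
  have hπprob : IsProbabilityMeasure π := isProbabilityMeasure_sparsityPrior hM0 hτ (by
    linarith [l1norm_nonneg lamStar])
  have hπ : ∀ᵐ lam ∂π, l1norm lam ≤ R := ae_sparsityPrior hτ R
  -- the posterior means and their risks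
  set D : (m : Fin (n + 1)) → Ω → Fin m → (Fin M → ℝ) × ℝ := fun m ω i =>
    (X (Fin.castLE (Nat.le_of_lt_succ m.2) i) ω, Y (Fin.castLE (Nat.le_of_lt_succ m.2) i) ω)
    with hD
  have hDm : ∀ m, Measurable (D m) := fun m => measurable_pi_lambda _ fun i => hZ _
  have hlaw : ∀ m, μ.map (D m) = Measure.pi fun _ => ν := fun m =>
    map_castLE_eq_pi hZ hindep (fun i => (hident i).map_eq) (Nat.le_of_lt_succ m.2)
  have hMA : ∀ ω, mirrorAveraging τ R β (fun i => X i ω) (fun i => Y i ω)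
      = (1 / ((n : ℝ) + 1)) • ∑ m, posteriorMean π β (D m ω) := fun ω =>
    mirrorAveraging_eq _ _
  have hpm : ∀ m, Measurable fun ω => posteriorMean π β (D m ω) := fun m =>
    (measurable_posteriorMean β).comp (hDm m)
  have hriskint : ∀ m, Integrable (fun ω => predRisk ν (posteriorMean π β (D m ω) - lamStar)) μ :=
    fun m => hν.integrable_predRisk (hpm m)
      (Filter.Eventually.of_forall fun ω => l1norm_posteriorMean_le hπ hβ0 _)
  have hrisk : ∀ m, ∫ ω, predRisk ν (posteriorMean π β (D m ω) - lamStar) ∂μ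
      = ∫ d, predRisk ν (posteriorMean π β d - lamStar) ∂(Measure.pi fun _ : Fin m => ν) :=
    fun m => by
    rw [← hlaw m, integral_map (hDm m).aemeasurable]
    exact ((measurable_predRisk hν.abs_le_one).comp
      ((measurable_posteriorMean β).sub measurable_const)).aestronglyMeasurable
  have havgint : Integrable (fun ω => 1 / ((n : ℝ) + 1) *
      ∑ m, predRisk ν (posteriorMean π β (D m ω) - lamStar)) μ :=
    (integrable_finsetSum _ fun m _ => hriskint m).const_mul _
  simp_rw [sqrtNormSq_secondMoment (hXmeas 0) (hYmeas 0) hν.abs_le_one, hMA]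
  have hmain : Integrable (fun ω => predRisk ν
      ((1 / ((n : ℝ) + 1)) • (∑ m, posteriorMean π β (D m ω)) - lamStar)) μ := by
    refine havgint.mono' ?_ (Filter.Eventually.of_forall fun ω => ?_)
    · refine ((measurable_predRisk hν.abs_le_one).comp
        (((Finset.measurable_sum _ fun m _ => hpm m).const_smul
          (1 / ((n : ℝ) + 1))).sub measurable_const)).aestronglyMeasurable
    · rw [Real.norm_of_nonneg (predRisk_nonneg _)]
      exact predRisk_average_le hν _
  refine ⟨hmain, ?_⟩
  -- the competitor: the sparsity prior centered at the true parameter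
  set p := (sparsityPrior M τ (2 * M * τ)).map fun w => w + lamStar with hp
  have hadd : Measurable fun w : Fin M → ℝ => w + lamStar := measurable_id.add_const _
  have hp0 := isProbabilityMeasure_sparsityPrior hM0 hτ (le_refl (2 * M * τ))
  have hpprob : IsProbabilityMeasure p := Measure.isProbabilityMeasure_map hadd.aemeasurable
  have hK : 0 < 2 * ∏ j, (1 + |lamStar j| / τ) ^ 4 := by positivity
  -- The average over `m = 0, …, n` has `n + 1` terms, so the telescoping ends at the evidence of `n
  -- + 1` observations. Only `n` exist on `Ω`; the extra one lives in the product law of `ν`, where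
  -- both bounds are stated.
  have hupper := hν.neg_integral_log_evidence_le hπ hβ0 hK
    (map_add_sparsityPrior_le hM0 hτ lamStar hlam) (n + 1)
  have hlower := hν.sum_integral_predRisk_le hπ hβ0 hβ (n + 1)
  have hvar : ∫ lam, predRisk ν (lam - lamStar) ∂p
      ≤ 4 * τ ^ 2 * (secondMoment μ (X 0)).trace := by
    have hm : Measurable fun lam => predRisk ν (lam - lamStar) :=
      (measurable_predRisk hν.abs_le_one).comp (measurable_id.sub_const _)
    rw [hp, integral_map hadd.aemeasurable hm.aestronglyMeasurable]
    simp only [add_sub_cancel_right]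
    refine (integral_predRisk_sparsityPrior_le hM0 hν.abs_le_one hτ).trans_eq ?_
    simp only [Matrix.trace, Matrix.diag, secondMoment_eq_map (hXmeas 0) (hYmeas 0)]
    rfl
  have hlog := mul_le_mul_of_nonneg_left (log_two_mul_prod_le hτ lamStar) hβ0.le
  rw [Finset.sum_range] at hlower
  have hsum : ∑ m : Fin (n + 1), ∫ ω, predRisk ν (posteriorMean π β (D m ω) - lamStar) ∂μ
      ≤ β * (1 + 4 * ∑ j, Real.log (1 + |lamStar j| / τ))
        + ((n : ℝ) + 1) * (4 * τ ^ 2 * (secondMoment μ (X 0)).trace) := by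
    simp_rw [hrisk]
    push_cast at hupper hlower
    have := mul_le_mul_of_nonneg_left hvar hn.le
    linarith
  calc ∫ ω, predRisk ν ((1 / ((n : ℝ) + 1)) • (∑ m, posteriorMean π β (D m ω)) - lamStar) ∂μ
      ≤ ∫ ω, 1 / ((n : ℝ) + 1) * ∑ m, predRisk ν (posteriorMean π β (D m ω) - lamStar) ∂μ :=
        integral_mono hmain havgint fun ω => predRisk_average_le hν _
    _ = 1 / ((n : ℝ) + 1) *
          ∑ m : Fin (n + 1), ∫ ω, predRisk ν (posteriorMean π β (D m ω) - lamStar) ∂μ := by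
        rw [integral_const_mul, integral_finsetSum _ fun m _ => hriskint m]
    _ ≤ 1 / ((n : ℝ) + 1) * (β * (1 + 4 * ∑ j, Real.log (1 + |lamStar j| / τ))
        + ((n : ℝ) + 1) * (4 * τ ^ 2 * (secondMoment μ (X 0)).trace)) := by gcongr
    _ = _ := by field_simp
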